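/- Let $p$ be an odd prime, let $K$ be a field of characteristic $p$, and let $G=\langle g\rangle$ be a finite cyclic group whose order is divisible by $p$. Put $A=KG$. Let $C^n(A)=\mathrm{Hom}_K(A^{\otimes n},A)$ with the Hochschild differential, and let $HH^n(A)$ be its $n$-th cohomology. Let $HH^{odd}(A)=\bigoplus_{r\ge 0}HH^{2r+1}(A)$, with the Gerstenhaber bracket, that is, the bracket induced by $[f,h]=f\circ h-(-1)^{(n-1)(m-1)}h\circ f$ for $f\in C^n(A)$, $h\in C^m(A)$, where $$(f\circ h)(a_1,\dots,a_{n+m-1})=\sum_{i=1}^{n}(-1)^{(i-1)(m-1)}f(a_1,\dots,a_{i-1},h(a_i,\dots,a_{i+m-1}),a_{i+m},\dots,a_{n+m-1}).$$ This makes $HH^{odd}(A)$ a Lie algebra, with $HH^1(A)$ as a Lie subalgebra. A derivation of $A$ is identified with its class in $HH^1(A)$. For $n=2r+1$ let $\beta^n:G^n\to K$ be the map with $\beta^{n}(g^{i_1},\dots,g^{i_n})=i_1$ if $i_{k}+i_{k+1}\ge |G|$ for every even $k$ with $2\le k<n$, and $0$ otherwise, where $0\le i_1,\dots,i_n<|G|$.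 For $x\in G$ let $\beta^{n}\otimes x$ be the cochain in $C^{n}(A)$ with $(x_1,\dots,x_n)\mapsto\beta^{n}(x_1,\dots,x_n)\,x_1\cdots x_n\,x$ for $x_1,\dots,x_n\in G$. Then for each integer $i\ge 0$ there is a derivation $D_i$ of $A$ with $D_i(g)=g^{i+1}$; these satisfy $[D_i,D_j]=(j-i)D_{i+j}$ and span $HH^1(A)$. The cochains $\beta^{2r+1}\otimes g^i$ are cocycles, and there is an isomorphism of Lie algebras over $K$ $$HH^{odd}(A)\;\cong\; HH^1(A)\otimes_K K[t]$$ that sends the class of $\beta^{2r+1}\otimes g^i$ to $D_i\otimes t^r$ for all $r,i\ge 0$. Here $HH^1(A)\otimes_K K[t]$ is the current Lie algebra, with bracket $[D_i\otimes t^r,D_j\otimes t^s]=[D_i,D_j]\otimes t^{r+s}$. -/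

import Mathlib

open scoped TensorProduct Polynomial DirectSum

noncomputable section

namespace Hochschild

section Cochains

variable (K : Type*) (A : Type*) [CommRing K] [Ring A] [Algebra K A]

/-- Hochschild `n`-cochains: `K`-multilinear maps `A ^ n → A`, i.e. `Hom_K (A ^ ⊗ n, A)`. -/
abbrev Coch (n : ℕ) : Type _ := MultilinearMap K (fun _ : Fin n => A) A

variable {K A}

/-- A tuple `(x 0, …, x (N - 1))`, continued by zero to a sequence. -/
def seq {N : ℕ} (x : Fin N → A) : ℕ → A := fun k => if h : k < N then x ⟨k, h⟩ else 0

/-- The value of a cochain on the first `n` terms of a sequence. -/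
def Coch.ev {n : ℕ} (f : Coch K A n) (x : ℕ → A) : A := f fun j => x j

/-- `(x 0, …, x (i - 1), a, x (i + m), x (i + m + 1), …)`: the block of length `m` that starts at
position `i` is replaced by the single entry `a` (for `m = 0`, `a` is inserted before `x i`). -/
def ins (i m : ℕ) (a : A) (x : ℕ → A) : ℕ → A :=
  fun j => if j < i then x j else if j = i then a else x (j + m - 1)

/-- The sequence `(x i, x (i + 1), …)`. -/
def shift (i : ℕ) (x : ℕ → A) : ℕ → A := fun k => x (i + k)

theorem seq_update {N : ℕ} [DecidableEq (Fin N)] (x : Fin N → A) (j : Fin N) (a : A) :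
    seq (Function.update x j a) = Function.update (seq x) (j : ℕ) a := by
  funext k
  by_cases h : k = j
  · subst h; simp [seq]
  · by_cases hk : k < N
    · have : (⟨k, hk⟩ : Fin N) ≠ j := fun e => h (by rw [← e])
      simp [seq, hk, Function.update_of_ne h, Function.update_of_ne this]
    · simp [seq, hk, Function.update_of_ne h]

theorem Coch.ev_congr {n : ℕ} (f : Coch K A n) {x y : ℕ → A} (h : ∀ k < n, x k = y k) :
    f.ev x = f.ev y :=
  congrArg f (funext fun j => h j j.2)

theorem ev_seq {n : ℕ} (f : Coch K A n) (x : Fin n → A) : f.ev (seq x) = f x := by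
  simp [Coch.ev, seq]

theorem ev_update_lt {n : ℕ} (f : Coch K A n) (x : ℕ → A) (j : ℕ) (hj : j < n) (a : A) :
    f.ev (Function.update x j a) = f (Function.update (fun k : Fin n => x k) ⟨j, hj⟩ a) := by
  unfold Coch.ev
  congr 1
  funext k
  by_cases h : k = ⟨j, hj⟩
  · subst h; simp
  · have : (k : ℕ) ≠ j := fun e => h (Fin.ext e)
    simp [Function.update_of_ne h, Function.update_of_ne this]

theorem ev_update_add {n : ℕ} (f : Coch K A n) (x : ℕ → A) (j : ℕ) (hj : j < n) (a b : A) :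
    f.ev (Function.update x j (a + b)) =
      f.ev (Function.update x j a) + f.ev (Function.update x j b) := by
  simp only [ev_update_lt f x j hj, f.map_update_add]

theorem ev_update_smul {n : ℕ} (f : Coch K A n) (x : ℕ → A) (j : ℕ) (hj : j < n) (c : K) (a : A) :
    f.ev (Function.update x j (c • a)) = c • f.ev (Function.update x j a) := by
  simp only [ev_update_lt f x j hj, f.map_update_smul]

theorem ins_eq_update (i m : ℕ) (a : A) (x : ℕ → A) :
    ins i m a x = Function.update (ins i m 0 x) i a := by
  funext j
  by_cases h : j = i
  · subst h; simp [ins]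
  · simp [ins, h]

theorem ev_ins_add {n : ℕ} (f : Coch K A n) (i m : ℕ) (hi : i < n) (a b : A) (x : ℕ → A) :
    f.ev (ins i m (a + b) x) = f.ev (ins i m a x) + f.ev (ins i m b x) := by
  rw [ins_eq_update, ev_update_add f _ _ hi, ← ins_eq_update, ← ins_eq_update]

theorem ev_ins_smul {n : ℕ} (f : Coch K A n) (i m : ℕ) (hi : i < n) (c : K) (a : A) (x : ℕ → A) :
    f.ev (ins i m (c • a) x) = c • f.ev (ins i m a x) := by
  rw [ins_eq_update, ev_update_smul f _ _ hi, ← ins_eq_update]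

theorem ins_update_lt (i m : ℕ) (a : A) (x : ℕ → A) (j : ℕ) (b : A) (h : j < i) :
    ins i m a (Function.update x j b) = Function.update (ins i m a x) j b := by
  funext k
  simp only [ins, Function.update_apply]
  grind

theorem ins_update_mid (i m : ℕ) (a : A) (x : ℕ → A) (j : ℕ) (b : A) (h : i ≤ j) (h' : j < i + m) :
    ins i m a (Function.update x j b) = ins i m a x := by
  funext k
  simp only [ins, Function.update_apply]
  grind

theorem ins_update_ge (i m : ℕ) (a : A) (x : ℕ → A) (j : ℕ) (b : A) (h : i + m ≤ j) :
    ins i m a (Function.update x j b) = Function.update (ins i m a x) (j + 1 - m) b := by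
  funext k
  simp only [ins, Function.update_apply]
  grind

theorem ev_shift_update_out {m : ℕ} (g : Coch K A m) (i : ℕ) (x : ℕ → A) (j : ℕ) (b : A)
    (h : j < i ∨ i + m ≤ j) :
    g.ev (shift i (Function.update x j b)) = g.ev (shift i x) := by
  refine g.ev_congr fun k hk => ?_
  simp only [shift, Function.update_apply]
  grind

theorem shift_update (i : ℕ) (x : ℕ → A) (j : ℕ) (b : A) (h : i ≤ j) :
    shift i (Function.update x j b) = Function.update (shift i x) (j - i) b := by
  funext k
  simp only [shift, Function.update_apply]
  grind

/-- The insertion `f ∘_i g`, with `i` counted from `0`: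
`(f ∘_i g)(x) = f (x 0, …, x (i - 1), g (x i, …, x (i + m - 1)), x (i + m), …, x (n + m - 2))`. -/
def circAt {n m N : ℕ} (h : n + m = N + 1) (f : Coch K A n) (g : Coch K A m) (i : Fin n) :
    Coch K A N where
  toFun x := f.ev (ins i m (g.ev (shift i (seq x))) (seq x))
  map_update_add' := by
    intro _ x j a b
    have hi := i.2
    have hj := j.2
    simp only [seq_update]
    rcases lt_or_ge (j : ℕ) i with h1 | h1
    · simp only [ev_shift_update_out g i _ _ _ (Or.inl h1), ins_update_lt _ _ _ _ _ _ h1]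
      exact ev_update_add f _ _ (by omega) _ _
    rcases lt_or_ge (j : ℕ) (i + m) with h2 | h2
    · simp only [ins_update_mid _ _ _ _ _ _ h1 h2, shift_update _ _ _ _ h1]
      rw [ev_update_add g _ _ (by omega), ev_ins_add f _ _ hi]
    · simp only [ev_shift_update_out g i _ _ _ (Or.inr h2), ins_update_ge _ _ _ _ _ _ h2]
      exact ev_update_add f _ _ (by omega) _ _
  map_update_smul' := by
    intro _ x j c a
    have hi := i.2
    have hj := j.2
    simp only [seq_update]
    rcases lt_or_ge (j : ℕ) i with h1 | h1
    · simp only [ev_shift_update_out g i _ _ _ (Or.inl h1), ins_update_lt _ _ _ _ _ _ h1]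
      exact ev_update_smul f _ _ (by omega) _ _
    rcases lt_or_ge (j : ℕ) (i + m) with h2 | h2
    · simp only [ins_update_mid _ _ _ _ _ _ h1 h2, shift_update _ _ _ _ h1]
      rw [ev_update_smul g _ _ (by omega), ev_ins_smul f _ _ hi]
    · simp only [ev_shift_update_out g i _ _ _ (Or.inr h2), ins_update_ge _ _ _ _ _ _ h2]
      exact ev_update_smul f _ _ (by omega) _ _

theorem ev_circAt {n m N : ℕ} (h : n + m = N + 1) (f : Coch K A n) (g : Coch K A m) (i : Fin n)
    (x : ℕ → A) : (circAt h f g i).ev x = f.ev (ins i m (g.ev (shift i x)) x) := by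
  have hi := i.2
  have hs : ∀ k < N, seq (fun j : Fin N => x j) k = x k := fun k hk => by simp [seq, hk]
  change f.ev (ins i m (g.ev (shift i (seq fun j : Fin N => x j))) (seq fun j : Fin N => x j)) = _
  rw [g.ev_congr (x := shift i (seq fun j : Fin N => x j)) (y := shift i x)
    fun k hk => hs _ (by omega)]
  refine f.ev_congr fun k hk => ?_
  simp only [ins]
  split_ifs with h1 h2
  · exact hs _ (by omega)
  · rfl
  · exact hs _ (by omega)

theorem ev_add {n : ℕ} (f g : Coch K A n) (x : ℕ → A) : (f + g).ev x = f.ev x + g.ev x := rfl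
theorem ev_sub {n : ℕ} (f g : Coch K A n) (x : ℕ → A) : (f - g).ev x = f.ev x - g.ev x := rfl
theorem ev_neg {n : ℕ} (f : Coch K A n) (x : ℕ → A) : (-f).ev x = -f.ev x := rfl
theorem ev_smul {n : ℕ} (c : K) (f : Coch K A n) (x : ℕ → A) : (c • f).ev x = c • f.ev x := rfl
theorem ev_zsmul {n : ℕ} (c : ℤ) (f : Coch K A n) (x : ℕ → A) : (c • f).ev x = c • f.ev x := rfl
theorem ev_sum {n : ℕ} {ι : Type*} (s : Finset ι) (f : ι → Coch K A n) (x : ℕ → A) :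
    (∑ i ∈ s, f i).ev x = ∑ i ∈ s, (f i).ev x := by
  simp [Coch.ev]

theorem Coch.ext_ev {n : ℕ} {f g : Coch K A n} (h : ∀ x, f.ev x = g.ev x) : f = g := by
  ext x
  rw [← ev_seq f, h, ev_seq]

/-- The Gerstenhaber product `f ∘ g = ∑_i (-1) ^ (i (m - 1)) f ∘_i g`, for `i = 0, …, n - 1`; it is
bilinear. (The exponent `i * (m + 1)` has the parity of `i (m - 1)` and makes sense for `m = 0`.) -/
def circ {n m N : ℕ} (h : n + m = N + 1) : Coch K A n →ₗ[K] Coch K A m →ₗ[K] Coch K A N :=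
  LinearMap.mk₂ K (fun f g => ∑ i : Fin n, (-1 : ℤ) ^ ((i : ℕ) * (m + 1)) • circAt h f g i)
    (fun f f' g => by
      refine Coch.ext_ev fun x => ?_
      simp only [ev_sum, ev_zsmul, ev_circAt, ev_add, smul_add, Finset.sum_add_distrib])
    (fun c f g => by
      refine Coch.ext_ev fun x => ?_
      simp only [ev_sum, ev_zsmul, ev_circAt, ev_smul, Finset.smul_sum]
      exact Finset.sum_congr rfl fun i _ => smul_comm _ _ _)
    (fun f g g' => by
      refine Coch.ext_ev fun x => ?_
      simp only [ev_sum, ev_zsmul, ev_circAt, ev_add, ev_ins_add f _ _ (Fin.is_lt _), smul_add,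
        Finset.sum_add_distrib])
    (fun c f g => by
      refine Coch.ext_ev fun x => ?_
      simp only [ev_sum, ev_zsmul, ev_circAt, ev_smul, ev_ins_smul f _ _ (Fin.is_lt _),
        Finset.smul_sum]
      exact Finset.sum_congr rfl fun i _ => smul_comm _ _ _)

theorem ev_circ {n m N : ℕ} (h : n + m = N + 1) (f : Coch K A n) (g : Coch K A m) (x : ℕ → A) :
    (circ h f g).ev x = ∑ i ∈ Finset.range n,
      (-1 : ℤ) ^ (i * (m + 1)) • f.ev (ins i m (g.ev (shift i x)) x) := by
  simp only [circ, LinearMap.mk₂_apply, ev_sum, ev_zsmul, ev_circAt]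
  exact Fin.sum_univ_eq_sum_range
    (fun i => (-1 : ℤ) ^ (i * (m + 1)) • f.ev (ins i m (g.ev (shift i x)) x)) n

/-- The Gerstenhaber bracket of cochains,
`[f, g] = f ∘ g - (-1) ^ ((n - 1) (m - 1)) g ∘ f`. -/
def gerst {n m N : ℕ} (h : n + m = N + 1) (f : Coch K A n) (g : Coch K A m) : Coch K A N :=
  circ h f g - (-1 : ℤ) ^ ((n + 1) * (m + 1)) • circ ((add_comm m n).trans h) g f

/-- The multiplication of `A` as a `2`-cochain. -/
def mulCoch : Coch K A 2 := MultilinearMap.mkPiAlgebraFin K 2 A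

theorem ev_mulCoch (x : ℕ → A) : (mulCoch : Coch K A 2).ev x = x 0 * x 1 := by
  simp [mulCoch, Coch.ev, MultilinearMap.mkPiAlgebraFin_apply]

theorem sum_triangle {M : Type*} [AddCommMonoid M] (n : ℕ) (G : ℕ → ℕ → M) :
    ∑ i ∈ Finset.range n, ∑ k ∈ Finset.range i, G k i =
      ∑ k ∈ Finset.range n, ∑ l ∈ Finset.range (n - 1 - k), G k (k + 1 + l) := by
  rw [Finset.sum_sigma', Finset.sum_sigma']
  refine Finset.sum_nbij' (fun s => ⟨s.2, s.1 - 1 - s.2⟩) (fun s => ⟨s.1 + 1 + s.2, s.1⟩)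
    ?_ ?_ ?_ ?_ ?_
  · rintro ⟨i, k⟩ h; simp at h ⊢; omega
  · rintro ⟨i, k⟩ h; simp at h ⊢; omega
  · rintro ⟨i, k⟩ h; simp at h ⊢; omega
  · rintro ⟨i, k⟩ h; simp at h ⊢
  · rintro ⟨i, k⟩ h
    simp at h
    have : k + 1 + (i - 1 - k) = i := by omega
    simp only [this]

theorem sign_congr {a b : ℕ} (h : a % 2 = b % 2) : (-1 : ℤ) ^ a = (-1) ^ b := by
  rw [neg_one_pow_eq_pow_mod_two, h, ← neg_one_pow_eq_pow_mod_two]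

/-- The insertions of `g` and `h` at two different places of `f`, with `g` to the left of `h`. -/
def twoIns {n m p : ℕ} (f : Coch K A n) (g : Coch K A m) (h : Coch K A p) (x : ℕ → A) : A :=
  ∑ i ∈ Finset.range n, ∑ l ∈ Finset.range (n - 1 - i),
    (-1 : ℤ) ^ ((i + m + l) * (p + 1) + i * (m + 1)) •
      f.ev (ins i m (g.ev (shift i x)) (ins (i + m + l) p (h.ev (shift (i + m + l) x)) x))

theorem ev_assoc {n m p N₁ N₂ N : ℕ} (h₁ : n + m = N₁ + 1) (h₂ : N₁ + p = N + 1)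
    (h₃ : m + p = N₂ + 1) (h₄ : n + N₂ = N + 1)
    (f : Coch K A n) (g : Coch K A m) (h : Coch K A p) (x : ℕ → A) :
    (circ h₂ (circ h₁ f g) h).ev x = (circ h₄ f (circ h₃ g h)).ev x +
      (twoIns f g h x + (-1 : ℤ) ^ ((m + 1) * (p + 1)) • twoIns f h g x) := by
  have key : ∀ i ∈ Finset.range n, ∀ F : ℕ → A, ∑ k ∈ Finset.range N₁, F k =
      ∑ k ∈ Finset.range i, F k + ∑ l ∈ Finset.range m, F (i + l) +
        ∑ l ∈ Finset.range (n - 1 - i), F (i + m + l) := by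
    intro i hi F
    have hi := Finset.mem_range.1 hi
    have : N₁ = (i + m) + (n - 1 - i) := by omega
    rw [this, Finset.sum_range_add, Finset.sum_range_add]
  rw [ev_circ]
  simp only [ev_circ, Finset.smul_sum]
  rw [Finset.sum_comm, Finset.sum_congr rfl fun i hi => key i hi _]
  rw [Finset.sum_add_distrib, Finset.sum_add_distrib]
  have e1 : ∑ i ∈ Finset.range n, ∑ l ∈ Finset.range m, (-1 : ℤ) ^ ((i + l) * (p + 1)) •
      (-1 : ℤ) ^ (i * (m + 1)) • f.ev (ins i m
        (g.ev (shift i (ins (i + l) p (h.ev (shift (i + l) x)) x)))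
          (ins (i + l) p (h.ev (shift (i + l) x)) x)) =
      ∑ i ∈ Finset.range n, (-1 : ℤ) ^ (i * (N₂ + 1)) • f.ev (ins i N₂
        (∑ l ∈ Finset.range m, (-1 : ℤ) ^ (l * (p + 1)) •
          g.ev (ins l p (h.ev (shift l (shift i x))) (shift i x))) x) := by
    refine Finset.sum_congr rfl fun i hi => ?_
    have hi := Finset.mem_range.1 hi
    let φ : A →+ A := AddMonoidHom.mk' (fun a => f.ev (ins i N₂ a x))
      fun a b => ev_ins_add f i N₂ hi a b x
    change _ = (-1 : ℤ) ^ (i * (N₂ + 1)) • φ _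
    rw [map_sum, Finset.smul_sum]
    refine Finset.sum_congr rfl fun l hl => ?_
    have hl := Finset.mem_range.1 hl
    rw [map_zsmul, smul_smul, smul_smul, ← pow_add, ← pow_add]
    change _ = _ • f.ev (ins i N₂ _ x)
    have s1 : shift i (ins (i + l) p (h.ev (shift (i + l) x)) x) =
        ins l p (h.ev (shift l (shift i x))) (shift i x) := by
      have : shift l (shift i x) = shift (i + l) x := by
        funext k; simp only [shift]; congr 1; omega
      rw [this]
      funext k
      simp only [shift, ins]
      grind
    have s2 : ∀ a b, ins i m a (ins (i + l) p b x) = ins i N₂ a x := by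
      intro a b
      funext k
      simp only [ins]
      grind
    rw [s1, s2]
    congr 1
    apply sign_congr
    have : i * (N₂ + 1) = i * (m + p) := by rw [h₃]
    rw [this]
    have : (i + l) * (p + 1) + i * (m + 1) = i * (m + p) + l * (p + 1) + 2 * i := by ring
    omega
  have e2 : ∑ i ∈ Finset.range n, ∑ k ∈ Finset.range i, (-1 : ℤ) ^ (k * (p + 1)) •
      (-1 : ℤ) ^ (i * (m + 1)) • f.ev (ins i m
        (g.ev (shift i (ins k p (h.ev (shift k x)) x)))
          (ins k p (h.ev (shift k x)) x)) =
      (-1 : ℤ) ^ ((m + 1) * (p + 1)) • twoIns f h g x := by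
    rw [sum_triangle n fun k i => (-1 : ℤ) ^ (k * (p + 1)) •
      (-1 : ℤ) ^ (i * (m + 1)) • f.ev (ins i m
        (g.ev (shift i (ins k p (h.ev (shift k x)) x)))
          (ins k p (h.ev (shift k x)) x))]
    simp only [twoIns, Finset.smul_sum]
    refine Finset.sum_congr rfl fun k hk => Finset.sum_congr rfl fun l hl => ?_
    rw [smul_smul, smul_smul, ← pow_add, ← pow_add]
    have s1 : shift (k + 1 + l) (ins k p (h.ev (shift k x)) x) = shift (k + p + l) x := by
      funext j
      simp only [shift, ins]
      grind
    have s2 : ∀ a b, ins (k + 1 + l) m a (ins k p b x) = ins k p b (ins (k + p + l) m a x) := by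
      intro a b
      funext j
      simp only [ins]
      grind
    rw [s1, s2]
    congr 1
    apply sign_congr
    have : (m + 1) * (p + 1) + ((k + p + l) * (m + 1) + k * (p + 1)) =
      k * (p + 1) + (k + 1 + l) * (m + 1) + 2 * (p * (m + 1)) := by ring
    omega
  have e3 : ∑ i ∈ Finset.range n, ∑ l ∈ Finset.range (n - 1 - i),
      (-1 : ℤ) ^ ((i + m + l) * (p + 1)) • (-1 : ℤ) ^ (i * (m + 1)) • f.ev (ins i m
        (g.ev (shift i (ins (i + m + l) p (h.ev (shift (i + m + l) x)) x)))
          (ins (i + m + l) p (h.ev (shift (i + m + l) x)) x)) = twoIns f g h x := by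
    simp only [twoIns]
    refine Finset.sum_congr rfl fun i hi => Finset.sum_congr rfl fun l hl => ?_
    rw [smul_smul, ← pow_add]
    have s1 : g.ev (shift i (ins (i + m + l) p (h.ev (shift (i + m + l) x)) x)) =
        g.ev (shift i x) := by
      refine g.ev_congr fun k hk => ?_
      simp only [shift, ins]
      grind
    rw [s1]
  rw [e1, e2, e3]
  abel

/-- The graded right pre-Lie identity. -/
theorem assoc_symm {n m p N₁ N₁' N₂ N₂' N : ℕ} (h₁ : n + m = N₁ + 1) (h₂ : N₁ + p = N + 1)
    (h₃ : m + p = N₂ + 1) (h₄ : n + N₂ = N + 1)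
    (h₁' : n + p = N₁' + 1) (h₂' : N₁' + m = N + 1)
    (h₃' : p + m = N₂' + 1) (h₄' : n + N₂' = N + 1)
    (f : Coch K A n) (g : Coch K A m) (h : Coch K A p) :
    circ h₂ (circ h₁ f g) h - circ h₄ f (circ h₃ g h) =
      (-1 : ℤ) ^ ((m + 1) * (p + 1)) •
        (circ h₂' (circ h₁' f h) g - circ h₄' f (circ h₃' h g)) := by
  refine Coch.ext_ev fun x => ?_
  have hs : (-1 : ℤ) ^ ((m + 1) * (p + 1)) * (-1 : ℤ) ^ ((m + 1) * (p + 1)) = 1 := by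
    rw [← pow_add, ← two_mul, pow_mul]; simp
  rw [ev_sub, ev_zsmul, ev_sub, ev_assoc h₁ h₂ h₃ h₄, ev_assoc h₁' h₂' h₃' h₄', mul_comm (p + 1)]
  rw [add_sub_cancel_left, add_sub_cancel_left, smul_add, smul_smul, hs, one_smul, add_comm]

theorem d_aux {n : ℕ} (f : Coch K A n) (x : Fin (n + 1) → A) :
    x 0 * f (Fin.tail x)
      + ∑ i : Fin n, (-1 : ℤ) ^ ((i : ℕ) + 1) • f (Fin.contractNth i.castSucc (· * ·) x)
      + (-1 : ℤ) ^ (n + 1) • (f (Fin.init x) * x (Fin.last n)) =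
    ((-1 : ℤ) ^ (n + 1) • circ (show 2 + n = (n + 1) + 1 by omega) mulCoch f -
      circ (show n + 2 = (n + 1) + 1 by omega) f mulCoch) x := by
  have hs : (-1 : ℤ) ^ (n + 1) * (-1 : ℤ) ^ (n + 1) = 1 := by
    rw [← pow_add, ← two_mul, pow_mul]; simp
  have hx : ∀ k (hk : k < n + 1), seq x k = x ⟨k, hk⟩ := fun k hk => by simp [seq, hk]
  rw [← ev_seq (_ - _) x, ev_sub, ev_zsmul, ev_circ, ev_circ]
  simp only [Finset.sum_range_succ, Finset.sum_range_zero, ev_mulCoch, zero_add, zero_mul,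
    pow_zero, one_smul, one_mul, smul_add, smul_smul, hs]
  have t0 : f (Fin.tail x) = f.ev (shift 1 (seq x)) := by
    refine congrArg f (funext fun j => ?_)
    simp only [shift]
    rw [hx _ (by omega)]
    simp only [Fin.tail]
    congr 1
    ext; simp; omega
  have t1 : f (Fin.init x) = f.ev (shift 0 (seq x)) := by
    refine congrArg f (funext fun j => ?_)
    simp only [shift]
    rw [hx _ (by omega)]
    simp only [Fin.init]
    congr 1
    ext; simp
  have t2 : ∑ i : Fin n, (-1 : ℤ) ^ ((i : ℕ) + 1) • f (Fin.contractNth i.castSucc (· * ·) x) =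
      - ∑ i ∈ Finset.range n, (-1 : ℤ) ^ (i * (2 + 1)) •
        f.ev (ins i 2 (shift i (seq x) 0 * shift i (seq x) 1) (seq x)) := by
    rw [← Fin.sum_univ_eq_sum_range (fun i => (-1 : ℤ) ^ (i * (2 + 1)) •
        f.ev (ins i 2 (shift i (seq x) 0 * shift i (seq x) 1) (seq x))) n, ← Finset.sum_neg_distrib]
    refine Finset.sum_congr rfl fun i _ => ?_
    rw [pow_succ, mul_neg_one, neg_smul, sign_congr (show (i : ℕ) % 2 = (i * (2 + 1)) % 2 by omega)]
    congr 2
    refine congrArg f (funext fun j => ?_)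
    have hi := i.2
    have hj := j.2
    simp only [ins, shift, Fin.contractNth, Fin.val_castSucc]
    split_ifs with h1 h2
    · rw [hx _ (by omega)]; rfl
    · rw [hx _ (by omega), hx _ (by omega)]
      congr 2 <;> ext <;> simp [h2]
    · rw [hx _ (by omega)]
      congr 1
  have u0 : ins 0 n (f.ev (shift 0 (seq x))) (seq x) 0 = f.ev (shift 0 (seq x)) := by simp [ins]
  have u1 : ins 0 n (f.ev (shift 0 (seq x))) (seq x) 1 = x (Fin.last n) := by
    simp only [ins]
    simp only [Nat.not_lt_zero, if_false, one_ne_zero]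
    rw [show 1 + n - 1 = n by omega, hx n (by omega)]
    rfl
  have u2 : ins 1 n (f.ev (shift 1 (seq x))) (seq x) 0 = x 0 := by
    simp only [ins]
    rw [if_pos (by omega), hx 0 (by omega)]
    rfl
  have u3 : ins 1 n (f.ev (shift 1 (seq x))) (seq x) 1 = f.ev (shift 1 (seq x)) := by simp [ins]
  rw [t0, t1, t2, u0, u1, u2, u3]
  abel

/-- The Hochschild differential `C ^ n (A) → C ^ (n + 1) (A)`,
`(δ f)(x 0, …, x n) = x 0 * f (x 1, …, x n) + ∑_{i < n} (-1) ^ (i + 1) f (…, x i * x (i + 1), …)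
  + (-1) ^ (n + 1) f (x 0, …, x (n - 1)) * x n`. -/
def d (n : ℕ) : Coch K A n →ₗ[K] Coch K A (n + 1) where
  toFun f :=
    { toFun := fun x =>
        x 0 * f (Fin.tail x)
          + ∑ i : Fin n, (-1 : ℤ) ^ ((i : ℕ) + 1) • f (Fin.contractNth i.castSucc (· * ·) x)
          + (-1 : ℤ) ^ (n + 1) • (f (Fin.init x) * x (Fin.last n))
      map_update_add' := by
        intro _ x j a b
        simp only [d_aux]
        convert MultilinearMap.map_update_add _ x j a b
      map_update_smul' := by
        intro _ x j c a
        simp only [d_aux]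
        convert MultilinearMap.map_update_smul _ x j c a }
  map_add' f g := by
    refine MultilinearMap.ext fun x => (d_aux (f + g) x).trans ?_
    have e : ∀ u v w z : Coch K A (n + 1), u + v - (w + z) = (u - w) + (v - z) := by
      intros; abel
    rw [map_add, map_add, LinearMap.add_apply, smul_add, e]
    exact (congrArg₂ (· + ·) (d_aux f x) (d_aux g x)).symm
  map_smul' c f := by
    refine MultilinearMap.ext fun x => (d_aux (c • f) x).trans ?_
    have e : ∀ u v : Coch K A (n + 1), c • u - c • v = c • (u - v) := by
      intro u v
      exact (smul_sub c u v).symm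
    rw [map_smul, map_smul, LinearMap.smul_apply, smul_comm _ c, e]
    exact (congrArg (c • ·) (d_aux f x)).symm

theorem d_eq {n : ℕ} (f : Coch K A n) :
    d n f = (-1 : ℤ) ^ (n + 1) • circ (show 2 + n = (n + 1) + 1 by omega) mulCoch f -
      circ (show n + 2 = (n + 1) + 1 by omega) f mulCoch := by
  ext x
  exact d_aux f x

theorem sign_even {a : ℕ} (h : a % 2 = 0) : (-1 : ℤ) ^ a = 1 := by
  rw [sign_congr (show a % 2 = 0 % 2 by omega), pow_zero]

theorem sign_odd {a : ℕ} (h : a % 2 = 1) : (-1 : ℤ) ^ a = -1 := by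
  rw [sign_congr (show a % 2 = 1 % 2 by omega), pow_one]

theorem mul_odd {a b : ℕ} (h : a % 2 = 1 ∨ b % 2 = 1) : ((a + 1) * (b + 1)) % 2 = 0 := by
  rcases h with h | h <;> rw [Nat.mul_mod]
  · rw [show (a + 1) % 2 = 0 by omega]; simp
  · rw [show (b + 1) % 2 = 0 by omega]; simp

theorem gerst_odd {n m N : ℕ} (h : n + m = N + 1) (ho : n % 2 = 1 ∨ m % 2 = 1)
    (f : Coch K A n) (g : Coch K A m) :
    gerst h f g = circ h f g - circ ((add_comm m n).trans h) g f := by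
  rw [gerst, sign_even (mul_odd ho), one_smul]

theorem d_odd {n : ℕ} (hn : n % 2 = 1) (f : Coch K A n) :
    d n f = circ (show 2 + n = (n + 1) + 1 by omega) mulCoch f -
      circ (show n + 2 = (n + 1) + 1 by omega) f mulCoch := by
  rw [d_eq, sign_even (by omega), one_smul]

theorem d_even {n : ℕ} (hn : n % 2 = 0) (f : Coch K A n) :
    d n f = - circ (show 2 + n = (n + 1) + 1 by omega) mulCoch f -
      circ (show n + 2 = (n + 1) + 1 by omega) f mulCoch := by
  rw [d_eq, sign_odd (by omega), neg_one_zsmul]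

/-- The bracket of two cocycles of odd degree is a cocycle. -/
theorem d_gerst_odd {a b N : ℕ} (h : a + b = N + 1) (ha : a % 2 = 1) (hb : b % 2 = 1)
    (f : Coch K A a) (g : Coch K A b) (hf : d _ f = 0) (hg : d _ g = 0) :
    d _ (gerst h f g) = 0 := by
  have A1 := assoc_symm (N := N + 1) h (by omega) (N₂ := b + 1) (by omega) (by omega)
    (N₁' := a + 1) (by omega) (by omega) (N₂' := b + 1) (by omega) (by omega)
    f g (mulCoch : Coch K A 2)
  have A2 := assoc_symm (N := N + 1) ((add_comm b a).trans h) (by omega)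
    (N₂ := a + 1) (by omega) (by omega)
    (N₁' := b + 1) (by omega) (by omega) (N₂' := a + 1) (by omega) (by omega)
    g f (mulCoch : Coch K A 2)
  have A3 := assoc_symm (N := N + 1) (N₁ := a + 1) (by omega) (by omega) h (by omega)
    (N₁' := b + 1) (by omega) (by omega) ((add_comm b a).trans h) (by omega)
    (mulCoch : Coch K A 2) f g
  rw [sign_even (mul_odd (by omega)), one_smul] at A1 A2 A3
  rw [d_odd ha, sub_eq_zero] at hf
  rw [d_odd hb, sub_eq_zero] at hg
  rw [d_odd (by omega), gerst_odd h (Or.inl ha)]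
  rw [hg] at A1 A3
  rw [hf] at A2 A3
  simp only [map_sub, LinearMap.sub_apply]
  grind

/-- The bracket of a cocycle of odd degree with a coboundary of odd degree is a coboundary. -/
theorem gerst_d {a b N : ℕ} (h : a + b = N + 1) (ha : a % 2 = 1) (hb : b % 2 = 0)
    (f : Coch K A a) (g : Coch K A b) (hf : d _ f = 0) :
    gerst (show a + (b + 1) = (N + 1) + 1 by omega) f (d _ g) = d _ (gerst h f g) := by
  have h' := (add_comm b a).trans h
  have A1 := assoc_symm (N := N + 1) h (by omega) (N₂ := b + 1) (by omega) (by omega)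
    (N₁' := a + 1) (by omega) (by omega) (N₂' := b + 1) (by omega) (by omega)
    f g (mulCoch : Coch K A 2)
  have A2 := assoc_symm (N := N + 1) h' (by omega)
    (N₂ := a + 1) (by omega) (by omega)
    (N₁' := b + 1) (by omega) (by omega) (N₂' := a + 1) (by omega) (by omega)
    g f (mulCoch : Coch K A 2)
  have A3 := assoc_symm (N := N + 1) (N₁ := a + 1) (by omega) (by omega) h (by omega)
    (N₁' := b + 1) (by omega) (by omega) h' (by omega)
    (mulCoch : Coch K A 2) f g
  rw [sign_odd (by rw [Nat.mul_mod, show (b + 1) % 2 = 1 by omega]), neg_one_zsmul] at A1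
  rw [sign_even (mul_odd (by omega)), one_smul] at A2 A3
  rw [d_odd ha, sub_eq_zero] at hf
  rw [d_even hb, d_even (by omega), gerst_odd h (Or.inl ha), gerst_odd _ (Or.inl ha)]
  rw [hf] at A2 A3
  simp only [map_sub, map_neg, LinearMap.sub_apply, LinearMap.neg_apply]
  grind

end Cochains

section Odd

variable (K : Type*) (A : Type*) [CommRing K] [Ring A] [Algebra K A]

/-- The cochains of odd degree, `⨁ r, C ^ (2 r + 1) (A)`. -/
def OddCoch : Type _ := ⨁ r : ℕ, Coch K A (2 * r + 1)

instance : AddCommGroup (OddCoch K A) :=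
  inferInstanceAs (AddCommGroup (⨁ r : ℕ, Coch K A (2 * r + 1)))

instance : Module K (OddCoch K A) :=
  inferInstanceAs (Module K (⨁ r : ℕ, Coch K A (2 * r + 1)))

variable {K A}

/-- The inclusion of `C ^ (2 r + 1) (A)`. -/
def single (r : ℕ) : Coch K A (2 * r + 1) →ₗ[K] OddCoch K A :=
  DirectSum.lof K ℕ (fun r => Coch K A (2 * r + 1)) r

/-- The component of degree `2 r + 1`. -/
def coord (r : ℕ) : OddCoch K A →ₗ[K] Coch K A (2 * r + 1) :=
  DirectSum.component K ℕ (fun r => Coch K A (2 * r + 1)) r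

theorem coord_single_same (r : ℕ) (f : Coch K A (2 * r + 1)) : coord r (single r f) = f :=
  DirectSum.component.lof_self K r (M := fun r => Coch K A (2 * r + 1)) f

theorem coord_single_ne {r s : ℕ} (h : r ≠ s) (f : Coch K A (2 * r + 1)) :
    coord s (single r f) = 0 :=
  DirectSum.of_eq_of_ne _ _ _ h.symm

/-- An odd cochain is the sum of its components. -/
theorem mem_of_components {S : AddSubmonoid (OddCoch K A)} {F : OddCoch K A}
    (h : ∀ r, single r (coord r F) ∈ S) : F ∈ S := by
  classical
  have : ∑ r ∈ DFinsupp.support (show ⨁ r : ℕ, Coch K A (2 * r + 1) from F),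
      single r (coord r F) = F := DirectSum.sum_support_of (β := fun r => Coch K A (2 * r + 1)) F
  rw [← this]
  exact sum_mem fun r _ => h r

theorem odd_induction {P : OddCoch K A → Prop} (F : OddCoch K A) (h0 : P 0)
    (h1 : ∀ r f, P (single r f)) (h2 : ∀ F G, P F → P G → P (F + G)) : P F :=
  mem_of_components (S := { carrier := {F | P F}, zero_mem' := h0, add_mem' := h2 _ _ })
    fun r => h1 r _

theorem single_congr {r s : ℕ} (h : r = s) {f : Coch K A (2 * r + 1)} {g : Coch K A (2 * s + 1)}
    (hfg : ∀ x, f.ev x = g.ev x) : single r f = single s g := by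
  subst h
  rw [Coch.ext_ev hfg]

theorem odd_add (r s : ℕ) : (2 * r + 1) + (2 * s + 1) = (2 * (r + s) + 1) + 1 := by omega

/-- The linear map on `⨁ r, C ^ (2 r + 1) (A)` with given restrictions to the summands. -/
def oddLift {M : Type*} [AddCommGroup M] [Module K M] (φ : ∀ r, Coch K A (2 * r + 1) →ₗ[K] M) :
    OddCoch K A →ₗ[K] M :=
  DirectSum.toModule K ℕ M φ

theorem oddLift_single {M : Type*} [AddCommGroup M] [Module K M]
    (φ : ∀ r, Coch K A (2 * r + 1) →ₗ[K] M) (r : ℕ) (f : Coch K A (2 * r + 1)) :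
    oddLift φ (single r f) = φ r f :=
  DirectSum.toModule_lof K (M := fun r => Coch K A (2 * r + 1)) r f

/-- The Gerstenhaber product of odd cochains. -/
def circOdd : OddCoch K A →ₗ[K] OddCoch K A →ₗ[K] OddCoch K A :=
  oddLift fun r => LinearMap.flip <| oddLift fun s => LinearMap.flip <|
    (circ (odd_add r s)).compr₂ (single (r + s))

theorem circOdd_single (r s : ℕ) (f : Coch K A (2 * r + 1)) (g : Coch K A (2 * s + 1)) :
    circOdd (single r f) (single s g) = single (r + s) (circ (odd_add r s) f g) := by
  simp only [circOdd, oddLift_single, LinearMap.flip_apply, LinearMap.compr₂_apply]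

theorem circOdd_assoc (F G H : OddCoch K A) :
    circOdd (circOdd F G) H - circOdd F (circOdd G H) =
      circOdd (circOdd F H) G - circOdd F (circOdd H G) := by
  induction F using odd_induction with
  | h0 => simp
  | h2 F F' h h' => simp only [map_add, LinearMap.add_apply]; grind
  | h1 r f =>
  induction G using odd_induction with
  | h0 => simp
  | h2 F F' h h' => simp only [map_add, LinearMap.add_apply]; grind
  | h1 s g =>
  induction H using odd_induction with
  | h0 => simp
  | h2 F F' h h' => simp only [map_add, LinearMap.add_apply]; grind
  | h1 t h =>
  have A := assoc_symm (N := 2 * (r + s + t) + 1) (odd_add r s) (odd_add (r + s) t) (odd_add s t)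
    (by omega) (odd_add r t) (by omega) (odd_add t s) (by omega) f g h
  rw [sign_even (mul_odd (by omega)), one_smul] at A
  have A' := congrArg (single (r + s + t)) A
  simp only [map_sub] at A'
  simp only [circOdd_single]
  convert A' using 2 <;> refine single_congr (by omega) fun x => ?_ <;> simp only [ev_circ]

/-- The Lie algebra of cochains of odd degree, with the Gerstenhaber bracket
`[F, G] = F ∘ G - G ∘ F` (the sign `(-1) ^ ((n - 1) (m - 1))` is `1` in odd degrees `n`, `m`). -/
instance : LieRing (OddCoch K A) where
  bracket F G := circOdd F G - circOdd G F
  add_lie F G H := by simp only [map_add, LinearMap.add_apply]; abel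
  lie_add F G H := by simp only [map_add, LinearMap.add_apply]; abel
  lie_self F := sub_self _
  leibniz_lie F G H := by
    have h1 := circOdd_assoc F G H
    have h2 := circOdd_assoc G F H
    have h3 := circOdd_assoc H F G
    simp only [map_sub, LinearMap.sub_apply]
    grind

instance : LieAlgebra K (OddCoch K A) where
  lie_smul c F G := by
    change circOdd F (c • G) - circOdd (c • G) F = c • (circOdd F G - circOdd G F)
    rw [map_smul, map_smul, LinearMap.smul_apply, smul_sub]

theorem lie_single (r s : ℕ) (f : Coch K A (2 * r + 1)) (g : Coch K A (2 * s + 1)) :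
    ⁅single r f, single s g⁆ = single (r + s) (gerst (odd_add r s) f g) := by
  rw [gerst_odd _ (by omega), map_sub]
  change circOdd _ _ - circOdd _ _ = _
  rw [circOdd_single, circOdd_single]
  congr 1
  exact single_congr (add_comm s r) fun x => by simp only [ev_circ]

variable (K A)

/-- The cocycles of odd degree. -/
def oddCocycles : LieSubalgebra K (OddCoch K A) where
  carrier := {F | ∀ r, d (2 * r + 1) (coord r F) = 0}
  add_mem' := by
    intro F G hF hG r
    rw [map_add, map_add, hF r, hG r, add_zero]
  zero_mem' := by intro r; simp
  smul_mem' := by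
    intro c F hF r
    rw [map_smul, map_smul, hF r, smul_zero]
  lie_mem' := by
    intro F G hF hG
    have hs : ∀ (t : ℕ) (f : Coch K A (2 * t + 1)), d _ f = 0 → ∀ r,
        d (2 * r + 1) (coord r (single t f)) = 0 := by
      intro t f hf r
      by_cases h : t = r
      · subst h; rwa [coord_single_same]
      · rw [coord_single_ne h, map_zero]
    let S : AddSubmonoid (OddCoch K A) :=
      { carrier := {F | ∀ r, d (2 * r + 1) (coord r F) = 0}
        add_mem' := by
          intro F G hF hG r
          rw [map_add, map_add, hF r, hG r, add_zero]
        zero_mem' := by intro r; simp }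
    change ⁅F, G⁆ ∈ S
    refine mem_of_components (S := S.comap (⟨⟨fun F => ⁅F, G⁆, by simp⟩, by simp⟩ :
      OddCoch K A →+ OddCoch K A)) (F := F) fun r => ?_
    change ⁅single r (coord r F), G⁆ ∈ S
    refine mem_of_components (S := S.comap (⟨⟨fun G => ⁅single r (coord r F), G⁆, by simp⟩,
      by simp⟩ : OddCoch K A →+ OddCoch K A)) (F := G) fun s => ?_
    change ⁅single r (coord r F), single s (coord s G)⁆ ∈ S
    rw [lie_single]
    exact hs _ _ (d_gerst_odd _ (by omega) (by omega) _ _ (hF r) (hG s))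

/-- The coboundaries of odd degree, an ideal of the Lie algebra of cocycles. -/
def oddCoboundaries : LieIdeal K (oddCocycles K A) where
  carrier := {F | ∀ r, ∃ h : Coch K A (2 * r), d (2 * r) h = coord r (F : OddCoch K A)}
  add_mem' := by
    intro F G hF hG r
    obtain ⟨f, hf⟩ := hF r
    obtain ⟨g, hg⟩ := hG r
    exact ⟨f + g, by rw [map_add, hf, hg]; exact (map_add (coord r) _ _).symm⟩
  zero_mem' := fun r => ⟨0, by rw [map_zero]; exact (map_zero (coord r)).symm⟩
  smul_mem' := by
    intro c F hF r
    obtain ⟨f, hf⟩ := hF r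
    exact ⟨c • f, by rw [map_smul, hf]; exact (map_smul (coord r) _ _).symm⟩
  lie_mem := by
    rintro ⟨F, hF⟩ ⟨G, hG'⟩ hG
    let S : AddSubmonoid (OddCoch K A) :=
      { carrier := {F | ∀ r, ∃ h : Coch K A (2 * r), d (2 * r) h = coord r F}
        add_mem' := by
          intro F G hF hG r
          obtain ⟨f, hf⟩ := hF r
          obtain ⟨g, hg⟩ := hG r
          exact ⟨f + g, by rw [map_add, hf, hg, map_add]⟩
        zero_mem' := fun r => ⟨0, by rw [map_zero, map_zero]⟩ }
    have hs : ∀ (t : ℕ) (f : Coch K A (2 * t)), single t (d (2 * t) f) ∈ S := by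
      intro t f r
      by_cases h : t = r
      · subst h; exact ⟨f, by rw [coord_single_same]⟩
      · exact ⟨0, by rw [coord_single_ne h, map_zero]⟩
    change ⁅F, G⁆ ∈ S
    refine mem_of_components (S := S.comap (⟨⟨fun F => ⁅F, G⁆, by simp⟩, by simp⟩ :
      OddCoch K A →+ OddCoch K A)) (F := F) fun r => ?_
    change ⁅single r (coord r F), G⁆ ∈ S
    refine mem_of_components (S := S.comap (⟨⟨fun G => ⁅single r (coord r F), G⁆, by simp⟩,
      by simp⟩ : OddCoch K A →+ OddCoch K A)) (F := G) fun s => ?_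
    change ⁅single r (coord r F), single s (coord s G)⁆ ∈ S
    obtain ⟨g, hg⟩ := hG s
    change d (2 * s) g = coord s G at hg
    rw [lie_single, ← hg, gerst_d (N := 2 * (r + s)) (by omega) (by omega) (by omega) _ _ (hF r)]
    exact hs _ _

/-- The odd part `HH ^ odd (A) = ⨁ r, HH ^ (2 r + 1) (A)` of Hochschild cohomology, as a Lie algebra
under the Gerstenhaber bracket. -/
abbrev HHodd : Type _ := oddCocycles K A ⧸ oddCoboundaries K A

variable {K A}

theorem single_mem (r : ℕ) (f : Coch K A (2 * r + 1)) (hf : d _ f = 0) :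
    single r f ∈ oddCocycles K A := by
  intro s
  by_cases h : r = s
  · subst h; rwa [coord_single_same]
  · rw [coord_single_ne h, map_zero]

variable (K A) in
/-- The space `Z ^ n (A)` of Hochschild cocycles of degree `n`. -/
abbrev Cocycle (n : ℕ) : Submodule K (Coch K A n) := LinearMap.ker (d n)

theorem Cocycle.d_eq_zero {n : ℕ} (f : Cocycle K A n) : d n (f : Coch K A n) = 0 := f.2

/-- A Hochschild cocycle of degree `2 r + 1`, as an element of `oddCocycles`. -/
def toOddCocycles (r : ℕ) : Cocycle K A (2 * r + 1) →ₗ[K] oddCocycles K A where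
  toFun f := ⟨single r (f : Coch K A (2 * r + 1)), single_mem r _ (Cocycle.d_eq_zero f)⟩
  map_add' _ _ := Subtype.ext (map_add (single r) _ _)
  map_smul' _ _ := Subtype.ext (map_smul (single r) _ _)

/-- The class in `HH ^ odd (A)` of a Hochschild cocycle of degree `2 r + 1`. -/
def cls (r : ℕ) : Cocycle K A (2 * r + 1) →ₗ[K] HHodd K A :=
  (LieSubmodule.Quotient.mk' (oddCoboundaries K A)).toLinearMap ∘ₗ toOddCocycles r

/-- The Gerstenhaber bracket of cocycles of odd degree. -/
def gerstCocycle (r s : ℕ) (f : Cocycle K A (2 * r + 1)) (g : Cocycle K A (2 * s + 1)) :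
    Cocycle K A (2 * (r + s) + 1) :=
  ⟨gerst (odd_add r s) (f : Coch K A (2 * r + 1)) (g : Coch K A (2 * s + 1)),
    LinearMap.mem_ker.2 (d_gerst_odd (odd_add r s) (by omega) (by omega) _ _
      (Cocycle.d_eq_zero f) (Cocycle.d_eq_zero g))⟩

/-- The bracket on `HH ^ odd (A)` is induced by the Gerstenhaber bracket of cochains. -/
theorem lie_cls (r s : ℕ) (f : Cocycle K A (2 * r + 1)) (g : Cocycle K A (2 * s + 1)) :
    ⁅cls r f, cls s g⁆ = cls (r + s) (gerstCocycle r s f g) := by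
  have h : toOddCocycles (r + s) (gerstCocycle r s f g) =
      ⁅toOddCocycles r f, toOddCocycles s g⁆ := Subtype.ext (lie_single r s _ _).symm
  change _ = LieSubmodule.Quotient.mk (N := oddCoboundaries K A)
    (toOddCocycles (r + s) (gerstCocycle r s f g))
  rw [h, LieSubmodule.Quotient.mk_bracket]
  rfl

variable (K A)

/-- `HH ^ 1 (A)`, the part of degree `1`, with the Gerstenhaber bracket. -/
def HH1 : LieSubalgebra K (HHodd K A) where
  __ := LinearMap.range (cls (K := K) (A := A) 0)
  lie_mem' := by
    rintro _ _ ⟨f, rfl⟩ ⟨g, rfl⟩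
    exact ⟨_, (lie_cls 0 0 f g).symm⟩

end Odd

section Derivations

variable {K A : Type*} [CommRing K] [CommRing A] [Algebra K A]

theorem d_derivation (D : Derivation K A A) :
    d 1 (MultilinearMap.ofSubsingleton K A A (0 : Fin 1) D.toLinearMap : Coch K A 1) = 0 := by
  ext x
  change x 0 * D _ + ∑ i : Fin 1, (-1 : ℤ) ^ ((i : ℕ) + 1) • D _ + (-1 : ℤ) ^ 2 • (D _ * _) = 0
  simp [Fin.tail, Fin.init, Fin.contractNth]
  ring

/-- A derivation of a commutative algebra, as an element of `HH ^ 1`. -/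
def derClass (D : Derivation K A A) : HH1 K A :=
  ⟨cls 0 (⟨_, LinearMap.mem_ker.2 (d_derivation D)⟩ : Cocycle K A 1), ⟨_, rfl⟩⟩

end Derivations

section GroupAlgebra

variable (K : Type*) {G : Type*} [Field K] [CommGroup G]

/-- The least `i` with `g ^ i = x`; this is the `i ∈ {0, …, |G| - 1}` with `x = g ^ i`, if `g`
generates the finite group `G`. -/
def expo (g x : G) : ℕ := sInf {i | g ^ i = x}

/-- `Q (x) = {y | x y < y}`, for the order `1 < g < g ^ 2 < ⋯ < g ^ (|G| - 1)`. -/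
def Q (g x : G) : Set G := {y | expo g (x * y) < expo g y}

/-- The condition `C (n)` on `(x 1, …, x n)`: `x i ∈ Q (x (i + 1))` for all odd `i` if `n` is even,
and for all even `i ≥ 2` if `n` is odd. (Here `x i` is the entry `x ⟨i - 1, _⟩`, so that
`j = i - 1` has the parity of `n`.) -/
def condC (g : G) (n : ℕ) (x : Fin n → G) : Prop :=
  ∀ (j : ℕ) (h : j + 1 < n), j % 2 = n % 2 → x ⟨j, by omega⟩ ∈ Q g (x ⟨j + 1, h⟩)

open Classical in
/-- The cochain `β ^ n : G ^ n → K`. -/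
def beta (g : G) (n : ℕ) (x : Fin n → G) : K :=
  if condC g n x then if h : Odd n then (expo g (x ⟨0, h.pos⟩) : K) else 1 else 0

variable {K} [Fintype G]

/-- The Hochschild cochain of `K G` that represents `α ⊗ x`, for a map `α : G ^ n → K` and `x ∈ G`:
on the basis, `(x 1, …, x n) ↦ α (x 1, …, x n) x 1 ⋯ x n x`. -/
def psi {n : ℕ} (α : (Fin n → G) → K) (x : G) : Coch K (MonoidAlgebra K G) n :=
  ∑ u : Fin n → G,
    ((MultilinearMap.mkPiAlgebra K (Fin n) K).compLinearMap fun i =>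
        Finsupp.lapply (u i) ∘ₗ (MonoidAlgebra.coeffLinearEquiv K).toLinearMap).smulRight
      (MonoidAlgebra.single ((∏ i, u i) * x) (α u))

theorem psi_single {n : ℕ} (α : (Fin n → G) → K) (x : G) (u : Fin n → G) :
    psi α x (fun i => MonoidAlgebra.single (u i) 1) =
      MonoidAlgebra.single ((∏ i, u i) * x) (α u) := by
  classical
  have h : ∀ v : Fin n → G, ∏ i, (Finsupp.single (u i) (1 : K)) (v i) = if v = u then 1 else 0 := by
    intro v
    split_ifs with hv
    · subst hv; simp
    · obtain ⟨i, hi⟩ := Function.ne_iff.1 hv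
      exact Finset.prod_eq_zero (Finset.mem_univ i) (Finsupp.single_eq_of_ne hi)
  have h' : psi α x (fun i => MonoidAlgebra.single (u i) 1) = ∑ v : Fin n → G,
      (∏ i, (Finsupp.single (u i) (1 : K)) (v i)) •
        MonoidAlgebra.single ((∏ i, v i) * x) (α v) := by
    simp [psi, MultilinearMap.smulRight]
  rw [h', Finset.sum_congr rfl fun v _ => by rw [h v, ite_smul, one_smul, zero_smul],
    Finset.sum_ite_eq' Finset.univ u]
  simp

end GroupAlgebra

end Hochschild

end

noncomputable section

namespace Hochschild

/-!
A Hochschild cochain of `K G` is a sum of cochains `α ⊗ x` with `α : G ^ n → K` and `x ∈ G`, and the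
Hochschild differential acts on `α` as the differential of group cochains with trivial coefficients.
The cochain `β ^ (2 r + 1)` is the cup product of the homomorphism `g ^ i ↦ i`, which is well
defined because `|G| = 0` in `K`, with `r` copies of the `2`-cocycle that records the carry in the
addition of exponents; so it is a cocycle. The functional `φ : f ↦ ∑ f (g, y₁, g, …, y_r, g)`,
summed over all `y₁, …, y_r` in `G`, vanishes on coboundaries, since the faces telescope, and takes
the value `1` on `β ^ (2 r + 1)`. As the odd cohomology of a cyclic group has dimension at most `1`,
the class of a cocycle `f` is `φ f` times the class of `β ^ (2 r + 1)`.

So the classes of the `β ^ (2 r + 1) ⊗ x` form a basis of `HH ^ odd (K G)`, and the bracket is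
determined by the values of `φ` on the Gerstenhaber products `(β ⊗ x) ∘ (β ⊗ z)`. There, on the
arguments `(g, y₁, g, …)`, consecutive insertions cancel, and only the first one contributes. The
result depends on `r` and `s` only through `r + s`, and for `r = s = 0` it is the commutator of
derivations.
-/

section GroupCochains

variable {K L G H : Type*} [CommRing K] [CommRing L] [Mul G] [Mul H]

/-- The differential of inhomogeneous group cochains with trivial coefficients. -/
def gdiff (n : ℕ) : ((Fin n → G) → K) →ₗ[K] (Fin (n + 1) → G) → K where
  toFun f x := f (Fin.tail x)
    + ∑ i : Fin n, (-1 : ℤ) ^ ((i : ℕ) + 1) • f (Fin.contractNth i.castSucc (· * ·) x)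
    + (-1 : ℤ) ^ (n + 1) • f (Fin.init x)
  map_add' f h := by
    funext x
    simp only [Pi.add_apply, smul_add, Finset.sum_add_distrib]
    abel
  map_smul' c f := by
    funext x
    simp only [Pi.smul_apply, RingHom.id_apply, smul_add, Finset.smul_sum, smul_comm _ c]

theorem gdiff_apply {n : ℕ} (f : (Fin n → G) → K) (x : Fin (n + 1) → G) :
    gdiff n f x = f (Fin.tail x)
      + ∑ i : Fin n, (-1 : ℤ) ^ ((i : ℕ) + 1) • f (Fin.contractNth i.castSucc (· * ·) x)
      + (-1 : ℤ) ^ (n + 1) • f (Fin.init x) := rfl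

theorem gdiff_comp_comp (φ : K →+ L) (ψ : H →ₙ* G) {n : ℕ} (f : (Fin n → G) → K) :
    gdiff n (fun u : Fin n → H => φ (f (ψ ∘ u))) = fun u => φ (gdiff n f (ψ ∘ u)) := by
  funext u
  simp only [gdiff_apply, map_add, map_sum, map_zsmul,
    Fin.comp_contractNth (· * ·) (· * ·) (map_mul ψ)]
  rfl

theorem contractNth_castSucc_eq_ins {n : ℕ} (U : ℕ → G) (i : Fin n) :
    Fin.contractNth i.castSucc (· * ·) (fun j : Fin (n + 1) => U j) =
      fun j : Fin n => ins i 2 (U i * U (i + 1)) U j := by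
  funext j
  simp only [Fin.contractNth, ins, Fin.val_castSucc]
  split_ifs with h1 h2
  · rfl
  · simp [h2]
  · rfl

theorem gdiff_seq {n : ℕ} (f : (Fin n → G) → K) (U : ℕ → G) :
    gdiff n f (fun j => U j) = f (fun j => U (j + 1))
      + ∑ i ∈ Finset.range n, (-1 : ℤ) ^ (i + 1) • f (fun j => ins i 2 (U i * U (i + 1)) U j)
      + (-1 : ℤ) ^ (n + 1) • f (fun j => U j) := by
  rw [gdiff_apply, ← Fin.sum_univ_eq_sum_range fun i =>
    (-1 : ℤ) ^ (i + 1) • f (fun j => ins i 2 (U i * U (i + 1)) U j)]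
  simp only [contractNth_castSucc_eq_ins]
  congr 2

end GroupCochains

section CyclicGroupCohomology

open CategoryTheory

theorem contractNth_last {α : Type*} {n : ℕ} (op : α → α → α) (x : Fin (n + 1) → α) :
    Fin.contractNth (Fin.last n) op x = Fin.init x :=
  funext fun k => Fin.contractNth_apply_of_lt _ _ _ _ k.is_lt

universe u v

theorem inhomogeneousCochains_d_trivial {K G : Type u} [CommRing K] [Monoid G] (n : ℕ)
    (f : (Fin n → G) → K) :
    (inhomogeneousCochains.d (Rep.trivial K G K) n).hom f = gdiff n f := by
  funext x
  rw [gdiff_apply, inhomogeneousCochains.d_hom_apply, Fin.sum_univ_castSucc, contractNth_last]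
  simp only [Fin.val_castSucc, Fin.val_last, ← add_assoc, zsmul_eq_mul, Int.cast_pow, Int.cast_neg,
    Int.cast_one]
  rfl

theorem exists_d_eq_iCocycles {K G : Type u} [CommRing K] [Group G] {A : Rep K G} {m : ℕ}
    {z : groupCohomology.cocycles A (m + 1)} (hz : groupCohomology.π A (m + 1) z = 0) :
    ∃ v : (Fin m → G) → A,
      inhomogeneousCochains.d A m v = groupCohomology.iCocycles A (m + 1) z := by
  let C := groupCohomology.inhomogeneousCochains A
  have exact : (ShortComplex.mk (C.toCycles m (m + 1)) (C.homologyπ (m + 1)) (by simp)).Exact :=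
    ShortComplex.exact_of_g_is_cokernel _ (C.homologyIsCokernel m (m + 1) (by simp))
  obtain ⟨v, rfl⟩ := (ShortComplex.moduleCat_exact_iff _).1 exact z hz
  refine ⟨v, ?_⟩
  rw [← groupCohomology.inhomogeneousCochains.d_def, ← C.toCycles_i m (m + 1)]
  rfl

theorem exists_smul_eq_of_odd {K G : Type u} [Field K] [CommGroup G] [Finite G] {g : G}
    (hg : ∀ x : G, x ∈ Subgroup.zpowers g) {n : ℕ} (hn : Odd n)
    {b : groupCohomology (Rep.trivial K G K) n} (hb : b ≠ 0)
    (c : groupCohomology (Rep.trivial K G K) n) : ∃ a : K, a • b = c := by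
  have := Fintype.ofFinite G
  let P := Rep.FiniteCyclicGroup.groupCohomologyπOdd (Rep.trivial K G K) g hg n hn
  have surjective : Function.Surjective P := (ModuleCat.epi_iff_surjective _).1
    (epi_comp' (@IsIso.epi_of_iso _ _ _ _ _ (Iso.isIso_inv _)) (epi_comp _ _))
  obtain ⟨⟨x, hx⟩, rfl⟩ := surjective b
  obtain ⟨⟨y, hy⟩, rfl⟩ := surjective c
  have hx₀ : (show K from x) ≠ 0 := fun h => hb <| by
    rw [show (⟨x, hx⟩ : LinearMap.ker _) = 0 from Subtype.ext h, map_zero]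
  refine ⟨(show K from y) / (show K from x), ?_⟩
  rw [← map_smul]
  exact congrArg P (Subtype.ext (div_mul_cancel₀ _ hx₀))

theorem exists_iCocycles_eq {K G : Type u} [CommRing K] [Group G] {n : ℕ} {f : (Fin n → G) → K}
    (hf : gdiff n f = 0) : ∃ z : groupCohomology.cocycles (Rep.trivial K G K) n,
      groupCohomology.iCocycles (Rep.trivial K G K) n z = f :=
  ⟨groupCohomology.cocyclesMk (A := Rep.trivial K G K) f
    ((inhomogeneousCochains_d_trivial n f).trans hf), groupCohomology.iCocycles_mk _ _⟩

theorem exists_eq_smul_add_gdiff_of_same_universe {K G : Type u} [Field K] [CommGroup G]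
    [Finite G] {g : G} (hg : ∀ x : G, x ∈ Subgroup.zpowers g) {m : ℕ} (hm : Odd (m + 1))
    {b f : (Fin (m + 1) → G) → K} (hb : gdiff _ b = 0) (hb' : ∀ v, gdiff m v ≠ b)
    (hf : gdiff _ f = 0) : ∃ (c : K) (v : (Fin m → G) → K), f = c • b + gdiff m v := by
  obtain ⟨zb, hzb⟩ := exists_iCocycles_eq hb
  obtain ⟨zf, hzf⟩ := exists_iCocycles_eq hf
  have class_ne_zero : groupCohomology.π _ _ zb ≠ 0 := fun h => by
    obtain ⟨v, hv⟩ := exists_d_eq_iCocycles h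
    exact hb' v ((inhomogeneousCochains_d_trivial m v).symm.trans (hv.trans hzb))
  obtain ⟨c, hc⟩ := exists_smul_eq_of_odd hg hm class_ne_zero (groupCohomology.π _ _ zf)
  obtain ⟨v, hv⟩ := exists_d_eq_iCocycles (z := zf - c • zb)
    (by rw [map_sub, map_smul, hc, sub_self])
  refine ⟨c, v, ?_⟩
  rw [map_sub, map_smul, hzb, hzf] at hv
  rw [← inhomogeneousCochains_d_trivial]
  exact eq_add_of_sub_eq' hv.symm

theorem exists_eq_smul_add_gdiff {K : Type u} {G : Type v} [Field K] [CommGroup G] [Finite G]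
    {g : G} (hg : ∀ x : G, x ∈ Subgroup.zpowers g) {m : ℕ} (hm : Odd (m + 1))
    {b f : (Fin (m + 1) → G) → K} (hb : gdiff _ b = 0) (hb' : ∀ v, gdiff m v ≠ b)
    (hf : gdiff _ f = 0) : ∃ (c : K) (v : (Fin m → G) → K), f = c • b + gdiff m v := by
  let upK : K ≃+* ULift.{v} K := ULift.ringEquiv.symm
  let upG : G ≃* ULift.{u} G := MulEquiv.ulift.symm
  let up {n : ℕ} (f : (Fin n → G) → K) (u : Fin n → ULift.{u} G) := upK (f (upG.symm ∘ u))
  let down {n : ℕ} (f : (Fin n → ULift.{u} G) → ULift.{v} K) (u : Fin n → G) :=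
    upK.symm (f (upG ∘ u))
  have gdiff_up {n : ℕ} (f : (Fin n → G) → K) : gdiff n (up f) = up (gdiff n f) :=
    gdiff_comp_comp upK.toAddMonoidHom upG.symm.toMulHom f
  have gdiff_down {n : ℕ} (f : (Fin n → ULift.{u} G) → ULift.{v} K) :
      gdiff n (down f) = down (gdiff n f) :=
    gdiff_comp_comp upK.symm.toAddMonoidHom upG.toMulHom f
  obtain ⟨c, v, hv⟩ := exists_eq_smul_add_gdiff_of_same_universe (g := upG g)
    (fun x => (hg (upG.symm x)).imp fun _ hk => congrArg upG hk)
    hm (b := up b) (f := up f) (by rw [gdiff_up, hb]; rfl)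
    (fun v hv => hb' (down v) ((gdiff_down v).trans (congrArg down hv)))
    (by rw [gdiff_up, hf]; rfl)
  exact ⟨upK.symm c, down v, (congrArg down hv).trans (by rw [gdiff_down]; rfl)⟩

end CyclicGroupCohomology

section CupProduct

variable {K G : Type*} [CommRing K]

/-- The cup product of group cochains,
`(a ∪ b) (u 0, …, u (n + m - 1)) = a (u 0, …, u (n - 1)) * b (u n, …, u (n + m - 1))`. -/
def cup {n m : ℕ} (a : (Fin n → G) → K) (b : (Fin m → G) → K) : (Fin (n + m) → G) → K :=
  fun u => a (u ∘ Fin.castAdd m) * b (u ∘ Fin.natAdd n)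

theorem cup_seq {n m : ℕ} (a : (Fin n → G) → K) (b : (Fin m → G) → K) (U : ℕ → G) :
    cup a b (fun j => U j) = a (fun j => U j) * b (fun j => U (n + j)) := rfl

theorem exists_seq_eq {α : Type*} [Nonempty α] {n : ℕ} (x : Fin n → α) :
    ∃ U : ℕ → α, (fun j : Fin n => U j) = x :=
  ⟨Function.extend Fin.val x fun _ => Classical.arbitrary α,
    funext fun j => Fin.val_injective.extend_apply x _ j⟩

variable [Mul G]

theorem gdiff_cup_seq {n m : ℕ} (a : (Fin n → G) → K) (b : (Fin m → G) → K) (U : ℕ → G) :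
    gdiff (n + m) (cup a b) (fun j => U j) =
      gdiff n a (fun j => U j) * b (fun j => U (n + 1 + j)) +
        (-1) ^ n * (a (fun j => U j) * gdiff m b (fun j => U (n + j))) := by
  have face_zero : cup a b (fun j => U (j + 1)) =
      a (fun j => U (j + 1)) * b (fun j => U (n + 1 + j)) := by
    simp only [cup_seq a b fun j => U (j + 1), add_right_comm]
  have face_left (i : ℕ) (hi : i < n) :
      cup a b (fun j => ins i 2 (U i * U (i + 1)) U j) =
        a (fun j => ins i 2 (U i * U (i + 1)) U j) * b (fun j => U (n + 1 + j)) := by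
    rw [cup_seq]
    congr 2
    funext j
    simp only [ins]
    grind
  have face_right (i : ℕ) :
      cup a b (fun j => ins (n + i) 2 (U (n + i) * U (n + i + 1)) U j) =
        a (fun j => U j) *
          b (fun j => ins i 2 (U (n + i) * U (n + (i + 1))) (fun k => U (n + k)) j) := by
    rw [cup_seq]
    congr 2 <;> funext j <;> simp only [ins] <;> grind
  have faces_right : ∑ i ∈ Finset.range m, (-1 : ℤ) ^ (n + i + 1) •
      cup a b (fun j => ins (n + i) 2 (U (n + i) * U (n + i + 1)) U j) =
        (-1) ^ n * (a (fun j => U j) * ∑ i ∈ Finset.range m, (-1 : ℤ) ^ (i + 1) •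
          b (fun j => ins i 2 (U (n + i) * U (n + (i + 1))) (fun k => U (n + k)) j)) := by
    simp only [face_right, Finset.mul_sum, zsmul_eq_mul]
    refine Finset.sum_congr rfl fun i _ => ?_
    push_cast
    ring
  rw [gdiff_seq, gdiff_seq a, gdiff_seq b fun k => U (n + k), Finset.sum_range_add, face_zero,
    faces_right, Finset.sum_congr rfl fun i hi => congrArg _ (face_left i (Finset.mem_range.1 hi)),
    cup_seq]
  simp only [← smul_mul_assoc, ← Finset.sum_mul, zsmul_eq_mul, add_right_comm n _ 1, ← add_assoc n]
  push_cast
  ring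

theorem gdiff_cup_eq_zero {n m : ℕ} {a : (Fin n → G) → K} {b : (Fin m → G) → K}
    (ha : gdiff n a = 0) (hb : gdiff m b = 0) : gdiff (n + m) (cup a b) = 0 := by
  funext x
  have : Nonempty G := ⟨x 0⟩
  obtain ⟨U, rfl⟩ := exists_seq_eq x
  rw [gdiff_cup_seq, ha, hb]
  simp

end CupProduct

section Carry

variable {G : Type*} [CommGroup G]

open Classical in
/-- The carry that occurs when the exponents of `u` and `v` are added modulo `|G|`: it is `1` if
`u ∈ Q (v)`, and `0` otherwise. -/
def carry (K : Type*) [CommRing K] (g u v : G) : K := if u ∈ Q g v then 1 else 0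

theorem carry_cast (K : Type*) [CommRing K] (g u v : G) : (carry ℤ g u v : K) = carry K g u v := by
  simp only [carry, Int.cast_ite, Int.cast_one, Int.cast_zero]

variable [Finite G] {g : G} (hg : ∀ x : G, x ∈ Subgroup.zpowers g)

include hg

theorem pow_expo (x : G) : g ^ expo g x = x :=
  Nat.sInf_mem (s := {i | g ^ i = x}) (mem_powers_iff_mem_zpowers.2 (hg x))

theorem expo_lt (x : G) : expo g x < Nat.card G := by
  have : expo g x ≤ expo g x % Nat.card G := Nat.sInf_le (s := {i | g ^ i = x}) <| by
    rw [Set.mem_ofPred_eq, pow_mod_natCard, pow_expo hg]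
  exact this.trans_lt (Nat.mod_lt _ Nat.card_pos)

theorem expo_pow (i : ℕ) : expo g (g ^ i) = i % Nat.card G := by
  have h := pow_expo hg (g ^ i)
  rwa [pow_inj_mod, orderOf_eq_card_of_forall_mem_zpowers hg, Nat.mod_eq_of_lt (expo_lt hg _)] at h

theorem expo_mul (x y : G) : expo g (x * y) = (expo g x + expo g y) % Nat.card G := by
  rw [← expo_pow hg, pow_add, pow_expo hg, pow_expo hg]

theorem expo_eq_zero_iff {x : G} : expo g x = 0 ↔ x = 1 := by
  refine ⟨fun h => by rw [← pow_expo hg x, h, pow_zero], fun h => ?_⟩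
  simpa [h] using expo_pow hg 0

theorem mem_Q_iff {u v : G} : u ∈ Q g v ↔ Nat.card G ≤ expo g u + expo g v := by
  have hu := expo_lt hg u
  have hv := expo_lt hg v
  rw [Q, Set.mem_ofPred_eq, expo_mul hg, Nat.add_comm (expo g v), Nat.add_mod_eq_ite]
  simp only [Nat.mod_eq_of_lt hu, Nat.mod_eq_of_lt hv]
  split_ifs <;> omega

theorem carry_comm (K : Type*) [CommRing K] (u v : G) : carry K g u v = carry K g v u := by
  simp only [carry, mem_Q_iff hg, add_comm]

theorem card_mul_carry (u v : G) :
    (Nat.card G : ℤ) * carry ℤ g u v = expo g u + expo g v - expo g (u * v) := by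
  have hu := expo_lt hg u
  have hv := expo_lt hg v
  simp only [carry, mem_Q_iff hg, expo_mul hg, Nat.add_mod_eq_ite, Nat.mod_eq_of_lt hu,
    Nat.mod_eq_of_lt hv]
  split_ifs <;> omega

theorem carry_add_carry (K : Type*) [CommRing K] (u v w : G) :
    carry K g v w + carry K g u (v * w) = carry K g (u * v) w + carry K g u v := by
  have over_int : carry ℤ g v w + carry ℤ g u (v * w) = carry ℤ g (u * v) w + carry ℤ g u v := by
    have card_ne_zero : (Nat.card G : ℤ) ≠ 0 := Nat.cast_ne_zero.2 Nat.card_pos.ne'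
    apply mul_left_cancel₀ card_ne_zero
    simp only [mul_add, card_mul_carry hg, mul_assoc]
    ring
  simpa only [Int.cast_add, carry_cast] using congrArg (Int.cast : ℤ → K) over_int

theorem gdiff_carry (K : Type*) [CommRing K] :
    gdiff 2 (fun u : Fin 2 → G => carry K g (u 0) (u 1)) = 0 := by
  funext x
  have : gdiff 2 (fun u : Fin 2 → G => carry K g (u 0) (u 1)) x =
      carry K g (x 1) (x 2) + ((-1 : ℤ) ^ 1 • carry K g (x 0 * x 1) (x 2) +
        (-1 : ℤ) ^ 2 • carry K g (x 0) (x 1 * x 2)) + (-1 : ℤ) ^ 3 • carry K g (x 0) (x 1) := by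
    rw [gdiff_apply, Fin.sum_univ_two]
    rfl
  rw [this, Pi.zero_apply]
  linear_combination carry_add_carry hg K (x 0) (x 1) (x 2)

omit [Finite G] in
theorem sum_carry [Fintype G] (K : Type*) [CommRing K] (w : G) : ∑ v, carry K g v w = expo g w := by
  classical
  have card_filter : ({v | Nat.card G ≤ expo g v + expo g w} : Finset G).card =
      (Finset.Ico (Nat.card G - expo g w) (Nat.card G)).card := by
    refine Finset.card_nbij' (expo g) (g ^ ·) (fun v hv => ?_) (fun i hi => ?_)
      (fun v _ => pow_expo hg v) (fun i hi => ?_)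
    · have := expo_lt hg v
      simp only [Finset.coe_filter, Finset.mem_univ, true_and, Set.mem_ofPred_eq, Finset.coe_Ico,
        Set.mem_Ico] at hv ⊢
      omega
    all_goals
      have hi := Finset.mem_Ico.1 hi
      have := expo_pow hg i
      rw [Nat.mod_eq_of_lt hi.2] at this
    · simp only [Finset.coe_filter, Finset.mem_univ, true_and, Set.mem_ofPred_eq, this]
      omega
    · exact this
  simp only [carry, mem_Q_iff hg, Finset.sum_boole]
  rw [card_filter, Nat.card_Ico, Nat.sub_sub_self (expo_lt hg w).le]

variable {K : Type*} [CommRing K] (hN : (Nat.card G : K) = 0)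

include hN

theorem expo_pow_cast (i : ℕ) : (expo g (g ^ i) : K) = i := by
  rw [expo_pow hg]
  conv_rhs => rw [← Nat.mod_add_div i (Nat.card G)]
  simp [hN]

theorem expo_self_cast : (expo g g : K) = 1 := by
  simpa using expo_pow_cast hg hN 1

theorem expo_mul_cast (x y : G) : (expo g (x * y) : K) = expo g x + expo g y := by
  rw [expo_mul hg, ← expo_pow hg, expo_pow_cast hg hN, Nat.cast_add]

theorem expo_inv_cast (x : G) : (expo g x⁻¹ : K) = -expo g x := by
  rw [eq_neg_iff_add_eq_zero, ← expo_mul_cast hg hN, inv_mul_cancel, (expo_eq_zero_iff hg).2 rfl,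
    Nat.cast_zero]

theorem gdiff_expo : gdiff 1 (fun u : Fin 1 → G => (expo g (u 0) : K)) = 0 := by
  funext x
  have : gdiff 1 (fun u : Fin 1 → G => (expo g (u 0) : K)) x =
      expo g (x 1) + (-1 : ℤ) ^ 1 • (expo g (x 0 * x 1) : K) + (-1 : ℤ) ^ 2 • expo g (x 0) := by
    rw [gdiff_apply, Fin.sum_univ_one]
    rfl
  rw [this, expo_mul_cast hg hN, Pi.zero_apply]
  ring

theorem carry_self_right [DecidableEq G] (v : G) :
    carry K g v g = if v = g⁻¹ then 1 else 0 := by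
  nontriviality K
  have one_lt_card : 1 < Nat.card G := by
    refine lt_of_le_of_ne Nat.card_pos fun h => one_ne_zero (α := K) ?_
    rwa [← h, Nat.cast_one] at hN
  have expo_self : expo g g = 1 := by
    simpa [Nat.mod_eq_of_lt one_lt_card] using expo_pow hg 1
  have : v ∈ Q g g ↔ v = g⁻¹ := by
    have hv := expo_lt hg v
    rw [mem_Q_iff hg, eq_inv_iff_mul_eq_one, ← expo_eq_zero_iff hg, expo_mul hg, expo_self,
      Nat.add_mod_eq_ite, Nat.mod_eq_of_lt hv, Nat.mod_eq_of_lt one_lt_card]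
    grind
  simp only [carry, this]

end Carry

section BetaCocycle

variable {K G : Type*} [Field K] [CommGroup G]

theorem beta_seq (g : G) (r : ℕ) (U : ℕ → G) :
    beta K g (2 * r + 1) (fun j => U j) =
      expo g (U 0) * ∏ k ∈ Finset.range r, carry K g (U (2 * k + 1)) (U (2 * k + 2)) := by
  classical
  have condC_iff : condC g (2 * r + 1) (fun j => U j) ↔
      ∀ k ∈ Finset.range r, U (2 * k + 1) ∈ Q g (U (2 * k + 2)) := by
    refine ⟨fun h k hk => ?_, fun h j hj hj' => ?_⟩
    · have hk := Finset.mem_range.1 hk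
      exact h (2 * k + 1) (by omega) (by omega)
    · obtain ⟨k, rfl⟩ : ∃ k, j = 2 * k + 1 := ⟨j / 2, by omega⟩
      exact h k (Finset.mem_range.2 (by omega))
  simp only [beta, carry, Finset.prod_ite_zero, condC_iff, dif_pos (odd_two_mul_add_one r),
    Finset.prod_const_one, mul_ite, mul_one, mul_zero]

theorem beta_succ (g : G) (r : ℕ) :
    beta K g (2 * (r + 1) + 1) =
      cup (beta K g (2 * r + 1)) fun u : Fin 2 → G => carry K g (u 0) (u 1) := by
  funext x
  obtain ⟨U, rfl⟩ := exists_seq_eq x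
  refine (beta_seq g (r + 1) U).trans (Eq.trans ?_ (cup_seq _ _ U).symm)
  rw [beta_seq, Finset.prod_range_succ, mul_assoc]
  rfl

theorem gdiff_beta [Finite G] {g : G} (hg : ∀ x : G, x ∈ Subgroup.zpowers g)
    (hN : (Nat.card G : K) = 0) (r : ℕ) : gdiff (2 * r + 1) (beta K g (2 * r + 1)) = 0 := by
  induction r with
  | zero =>
    convert gdiff_expo hg hN using 2
    funext x
    obtain ⟨U, rfl⟩ := exists_seq_eq x
    exact (beta_seq g 0 U).trans (by simp)
  | succ r ih =>
    rw [beta_succ]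
    exact gdiff_cup_eq_zero ih (gdiff_carry hg K)

end BetaCocycle

section PeriodicFunctional

/-- The sequence `(g, y 0, g, y 1, g, …)`. -/
def zigzag {G : Type*} (g : G) (y : ℕ → G) : ℕ → G := fun k => if Even k then g else y (k / 2)

section Zigzag

variable {G : Type*} {g : G} {y : ℕ → G}

theorem zigzag_of_even {i : ℕ} (hi : Even i) : zigzag g y i = g := if_pos hi

theorem zigzag_of_eq {i k : ℕ} (hi : i = 2 * k + 1) : zigzag g y i = y k := by
  rw [hi, zigzag, if_neg (Nat.not_even_two_mul_add_one k)]
  congr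
  omega

theorem update_zigzag (k : ℕ) (a : G) :
    Function.update (zigzag g y) (2 * k + 1) a = zigzag g (Function.update y k a) := by
  funext j
  obtain ⟨i, rfl | rfl⟩ := Nat.even_or_odd' j
  · rw [zigzag_of_even (even_two_mul i), Function.update_of_ne (by omega),
      zigzag_of_even (even_two_mul i)]
  · simp [Function.update_apply, zigzag_of_eq rfl]

end Zigzag

/-- A sequence with its entry at position `i` deleted. -/
def skip {α : Type*} (i : ℕ) (U : ℕ → α) : ℕ → α := fun j => if j < i then U j else U (j + 1)

theorem ins_two_eq_skip_update {α : Type*} (i : ℕ) (a : α) (U : ℕ → α) :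
    ins i 2 a U = skip i (Function.update U (i + 1) a) := by
  funext j
  simp only [ins, skip, Function.update_apply]
  grind

theorem ins_two_eq_skip_succ_update {α : Type*} (i : ℕ) (a : α) (U : ℕ → α) :
    ins i 2 a U = skip (i + 1) (Function.update U i a) := by
  funext j
  simp only [ins, skip, Function.update_apply]
  grind

/-- The tuple `y`, continued by `1` to a sequence. -/
def seqOne {G : Type*} [One G] {t : ℕ} (y : Fin t → G) : ℕ → G := Function.extend Fin.val y 1

theorem seqOne_coe {G : Type*} [One G] {t : ℕ} (y : Fin t → G) (k : Fin t) : seqOne y k = y k :=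
  Fin.val_injective.extend_apply y 1 k

theorem seqOne_update {G : Type*} [One G] {t : ℕ} (y : Fin t → G) (k : Fin t) (a : G) :
    seqOne (Function.update y k a) = Function.update (seqOne y) k a := by
  funext j
  by_cases hj : j < t
  · obtain ⟨j, rfl⟩ : ∃ i : Fin t, (i : ℕ) = j := ⟨⟨j, hj⟩, rfl⟩
    simp only [seqOne_coe, Function.update_apply, Fin.ext_iff]
  · have not_mem : ¬∃ i : Fin t, (i : ℕ) = j := by
      rintro ⟨i, rfl⟩
      exact hj i.is_lt
    rw [Function.update_of_ne fun h => not_mem ⟨k, h.symm⟩, seqOne, seqOne,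
      Function.extend_apply' _ _ _ not_mem, Function.extend_apply' _ _ _ not_mem]

@[to_additive]
theorem prod_range_double {M : Type*} [CommMonoid M] (F : ℕ → M) (t : ℕ) :
    ∏ i ∈ Finset.range (2 * t), F i = ∏ k ∈ Finset.range t, (F (2 * k) * F (2 * k + 1)) := by
  induction t with
  | zero => rfl
  | succ t ih =>
    rw [Nat.mul_succ, Finset.prod_range_succ, Finset.prod_range_succ, Finset.prod_range_succ, ih,
      mul_assoc]

theorem gdiff_zigzag {K G : Type*} [CommRing K] [Mul G] (g : G) (t : ℕ)
    (u : (Fin (2 * t) → G) → K) (y : ℕ → G) :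
    gdiff (2 * t) u (fun j => zigzag g y j) =
      (u fun j => skip (2 * 0) (zigzag g y) j) +
        ∑ k ∈ Finset.range t,
          ((u fun j => skip (2 * (k + 1)) (zigzag g (Function.update y k (y k * g))) j) -
            u fun j => skip (2 * k) (zigzag g (Function.update y k (g * y k))) j) -
        u fun j => skip (2 * t) (zigzag g y) j := by
  have face_last : (fun j : Fin (2 * t) => zigzag g y j) =
      fun j : Fin (2 * t) => skip (2 * t) (zigzag g y) j :=
    funext fun j => (if_pos j.is_lt).symm
  have face_even (k : ℕ) : ins (2 * k) 2 (g * y k) (zigzag g y) =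
      skip (2 * k) (zigzag g (Function.update y k (g * y k))) := by
    rw [ins_two_eq_skip_update, update_zigzag]
  have face_odd (k : ℕ) : ins (2 * k + 1) 2 (y k * g) (zigzag g y) =
      skip (2 * (k + 1)) (zigzag g (Function.update y k (y k * g))) := by
    rw [ins_two_eq_skip_succ_update, update_zigzag]
    rfl
  have sign_odd (k : ℕ) : (-1 : ℤ) ^ (2 * k + 1) = -1 := (odd_two_mul_add_one k).neg_one_pow
  have sign_even (k : ℕ) : (-1 : ℤ) ^ (2 * k + 1 + 1) = 1 :=
    (odd_two_mul_add_one k).add_one.neg_one_pow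
  have zigzag_even (k : ℕ) : zigzag g y (2 * k) = g := zigzag_of_even (even_two_mul k)
  have zigzag_even' (k : ℕ) : zigzag g y (2 * k + 1 + 1) = g := zigzag_even (k + 1)
  rw [gdiff_seq, sum_range_double, face_last]
  simp only [zigzag_even, zigzag_of_eq rfl, zigzag_even', face_even, face_odd, sign_odd, sign_even,
    neg_smul, one_smul, neg_add_eq_sub, ← sub_eq_add_neg]
  rfl

variable {G : Type*} [Fintype G]

theorem sum_update_seqOne [One G] {M : Type*} [AddCommMonoid M] {t k : ℕ} (hk : k < t)
    (σ : Equiv.Perm G) (F : (ℕ → G) → M) :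
    ∑ y : Fin t → G, F (Function.update (seqOne y) k (σ (seqOne y k))) =
      ∑ y : Fin t → G, F (seqOne y) := by
  classical
  let k' : Fin t := ⟨k, hk⟩
  refine Fintype.sum_equiv (Equiv.piCongrRight (Function.update (fun _ => Equiv.refl G) k' σ)) _ _
    fun y => congrArg F ?_
  rw [show k = k' from rfl, seqOne_coe, ← seqOne_update]
  congr 1
  funext j
  obtain rfl | hj := eq_or_ne j k'
  · simp
  · simp [hj]

variable {K : Type*} [CommRing K]

/-- The functional `f ↦ ∑ f (g, y 1, g, …, y t, g)` on cochains of degree `2 * t + 1`, the sum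
being over all `y 1, …, y t` in `G`. It detects the cohomology of a cyclic group in odd degrees. -/
def phi [One G] (g : G) (t : ℕ) : ((Fin (2 * t + 1) → G) → K) →ₗ[K] K :=
  ∑ y : Fin t → G, LinearMap.proj fun j : Fin (2 * t + 1) => zigzag g (seqOne y) j

theorem phi_apply [One G] (g : G) (t : ℕ) (f : (Fin (2 * t + 1) → G) → K) :
    phi g t f = ∑ y : Fin t → G, f fun j => zigzag g (seqOne y) j := by
  simp only [phi, LinearMap.sum_apply, LinearMap.proj_apply]

theorem phi_gdiff [Group G] (g : G) (t : ℕ) (u : (Fin (2 * t) → G) → K) :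
    phi g t (gdiff (2 * t) u) = 0 := by
  let S (k : ℕ) : K := ∑ y : Fin t → G, u fun j => skip (2 * k) (zigzag g (seqOne y)) j
  have sum_faces (k : ℕ) (hk : k ∈ Finset.range t) : ∑ y : Fin t → G,
      ((u fun j => skip (2 * (k + 1))
          (zigzag g (Function.update (seqOne y) k (seqOne y k * g))) j) -
        u fun j => skip (2 * k) (zigzag g (Function.update (seqOne y) k (g * seqOne y k))) j) =
      S (k + 1) - S k := by
    have hk := Finset.mem_range.1 hk
    rw [Finset.sum_sub_distrib]
    congr 1
    · exact sum_update_seqOne hk (Equiv.mulRight g)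
        fun y => u fun j => skip (2 * (k + 1)) (zigzag g y) j
    · exact sum_update_seqOne hk (Equiv.mulLeft g) fun y => u fun j => skip (2 * k) (zigzag g y) j
  simp only [phi_apply, gdiff_zigzag, Finset.sum_sub_distrib (f := fun _ => _ + _),
    Finset.sum_add_distrib]
  rw [Finset.sum_comm, Finset.sum_congr rfl sum_faces, Finset.sum_range_sub]
  exact sub_eq_zero.2 (add_sub_cancel (S 0) (S t))

theorem sum_prod_seqOne [One G] {t : ℕ} (F : ℕ → G → K) :
    ∑ y : Fin t → G, ∏ k ∈ Finset.range t, F k (seqOne y k) =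
      ∏ k ∈ Finset.range t, ∑ v, F k v := by
  classical
  simp only [Finset.prod_range, seqOne_coe, Finset.prod_univ_sum, Fintype.piFinset_univ]

theorem sum_prod_seqOne_eq_one [One G] {t : ℕ} {c : G → K} (hc : ∑ v, c v = 1) :
    ∑ y : Fin t → G, ∏ k ∈ Finset.range t, c (seqOne y k) = 1 := by
  rw [sum_prod_seqOne fun _ => c, hc, Finset.prod_const_one]

theorem sum_prod_mul_mul_prod_seqOne [One G] {t j m : ℕ} (ht : t = j + 1 + m) {c : G → K}
    (hc : ∑ v, c v = 1) (F : G → K) :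
    ∑ y : Fin t → G, (∏ k ∈ Finset.range j, c (seqOne y k)) * F (seqOne y j) *
      ∏ k ∈ Finset.range m, c (seqOne y (j + 1 + k)) = ∑ v, F v := by
  let f (k : ℕ) : G → K := if k = j then F else c
  have f_lt (k : ℕ) (hk : k ∈ Finset.range j) : f k = c := if_neg (Finset.mem_range.1 hk).ne
  have f_self : f j = F := if_pos rfl
  have f_gt (k : ℕ) : f (j + 1 + k) = c := if_neg (by omega)
  subst ht
  have prod_values (y : ℕ → G) : ∏ k ∈ Finset.range (j + 1 + m), f k (y k) =
      (∏ k ∈ Finset.range j, c (y k)) * F (y j) * ∏ k ∈ Finset.range m, c (y (j + 1 + k)) := by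
    rw [Finset.prod_range_add, Finset.prod_range_succ, f_self,
      Finset.prod_congr rfl fun k hk => congrFun (f_lt k hk) (y k)]
    simp only [f_gt]
  have prod_sums : ∏ k ∈ Finset.range (j + 1 + m), ∑ v, f k v = ∑ v, F v := by
    rw [Finset.prod_range_add, Finset.prod_range_succ, f_self,
      Finset.prod_congr rfl fun k hk => by rw [f_lt k hk, hc]]
    simp only [f_gt, hc, Finset.prod_const_one, one_mul, mul_one]
  simp only [← prod_values]
  exact (sum_prod_seqOne f).trans prod_sums

end PeriodicFunctional

section GroupCirc

theorem ins_of_lt {α : Type*} {i m j : ℕ} {a : α} {U : ℕ → α} (hj : j < i) :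
    ins i m a U j = U j := if_pos hj

theorem ins_self {α : Type*} {i m : ℕ} {a : α} {U : ℕ → α} : ins i m a U i = a := by simp [ins]

theorem ins_of_gt {α : Type*} {i m j : ℕ} {a : α} {U : ℕ → α} (hj : i < j) :
    ins i m a U j = U (j + m - 1) := by
  rw [ins, if_neg (by omega), if_neg (by omega)]

theorem comp_ins {α β : Type*} (φ : α → β) (i m : ℕ) (a : α) (U : ℕ → α) :
    ins i m (φ a) (fun k => φ (U k)) = fun k => φ (ins i m a U k) := by
  funext k
  simp only [ins, apply_ite φ]

theorem prod_ins {M : Type*} [CommMonoid M] {n m N i : ℕ} (h : n + m = N + 1) (hi : i < n)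
    (z : M) (U : ℕ → M) :
    ∏ j ∈ Finset.range n, ins i m ((∏ k ∈ Finset.range m, shift i U k) * z) U j =
      (∏ j ∈ Finset.range N, U j) * z := by
  obtain ⟨l, rfl⟩ : ∃ l, n = i + 1 + l := ⟨n - (i + 1), by omega⟩
  obtain rfl : N = i + m + l := by omega
  rw [Finset.prod_range_add, Finset.prod_range_succ, ins_self,
    Finset.prod_congr rfl fun j hj => ins_of_lt (Finset.mem_range.1 hj),
    Finset.prod_congr rfl fun j _ => ins_of_gt (show i < i + 1 + j by omega),
    Finset.prod_range_add, Finset.prod_range_add]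
  simp only [shift, mul_assoc, mul_comm z, show ∀ j, i + 1 + j + m - 1 = i + m + j by omega]

variable {K G : Type*} [CommRing K] [CommGroup G]

/-- The coefficient of the `q`-th insertion (counted from `0`) of `b ⊗ z` into `a ⊗ x`, for group
cochains `a` and `b`; it does not depend on `x`. -/
def circTerm {n m : ℕ} (a : (Fin n → G) → K) (b : (Fin m → G) → K) (z : G) (q : ℕ) (U : ℕ → G) :
    K :=
  b (fun j => shift q U j) *
    a fun j => ins q m ((∏ k ∈ Finset.range m, shift q U k) * z) U j

theorem circTerm_congr {n m N q : ℕ} (h : n + m = N + 1) (hq : q < n) (a : (Fin n → G) → K)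
    (b : (Fin m → G) → K) (z : G) {U V : ℕ → G} (hUV : ∀ k < N, U k = V k) :
    circTerm a b z q U = circTerm a b z q V := by
  have shift_eq (k : ℕ) (hk : k < m) : shift q U k = shift q V k := hUV _ (by omega)
  rw [circTerm, circTerm, Finset.prod_congr rfl fun k hk => shift_eq k (Finset.mem_range.1 hk)]
  congr 2 <;> funext j
  · exact shift_eq j j.is_lt
  · simp only [ins]
    split_ifs with h₁ h₂
    · exact hUV _ (by omega)
    · rfl
    · exact hUV _ (by omega)

/-- The group cochain `c` for which the Gerstenhaber product `(a ⊗ x) ∘ (b ⊗ z)` is `c ⊗ x z`. -/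
def groupCirc {n m N : ℕ} (_ : n + m = N + 1) (a : (Fin n → G) → K) (b : (Fin m → G) → K) (z : G) :
    (Fin N → G) → K :=
  fun u => ∑ q ∈ Finset.range n, (-1 : ℤ) ^ (q * (m + 1)) • circTerm a b z q (seqOne u)

theorem groupCirc_seq {n m N : ℕ} (h : n + m = N + 1) (a : (Fin n → G) → K) (b : (Fin m → G) → K)
    (z : G) (U : ℕ → G) :
    groupCirc h a b z (fun j => U j) =
      ∑ q ∈ Finset.range n, (-1 : ℤ) ^ (q * (m + 1)) • circTerm a b z q U :=
  Finset.sum_congr rfl fun _ hq => congrArg _ <|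
    circTerm_congr h (Finset.mem_range.1 hq) a b z fun k hk => seqOne_coe _ (⟨k, hk⟩ : Fin N)

end GroupCirc

section Components

theorem prod_contractNth_castSucc {M : Type*} [CommMonoid M] {n : ℕ} (i : Fin n)
    (u : Fin (n + 1) → M) : ∏ k, Fin.contractNth i.castSucc (· * ·) u k = ∏ k, u k := by
  obtain ⟨U, rfl⟩ := exists_seq_eq u
  have := prod_ins (show n + 2 = (n + 1) + 1 by rfl) i.is_lt 1 U
  simpa only [contractNth_castSucc_eq_ins, Finset.prod_range, Fin.prod_univ_two, shift, mul_one,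
    Fin.val_zero, Fin.val_one, add_zero] using this

section CommRing

variable {K G : Type*} [CommRing K] [CommGroup G]

/-- The component at `x` of a Hochschild cochain of `K G`: the map `α : G ^ n → K` such that `f` is
the sum of the cochains `α ⊗ x` over all `x` in `G`. -/
def comp (n : ℕ) (x : G) : Coch K (MonoidAlgebra K G) n →ₗ[K] (Fin n → G) → K where
  toFun f u := (f fun i => MonoidAlgebra.single (u i) 1).coeff ((∏ i, u i) * x)
  map_add' f h := by
    funext u
    simp
  map_smul' c f := by
    funext u
    simp

theorem comp_apply {n : ℕ} (x : G) (f : Coch K (MonoidAlgebra K G) n) (u : Fin n → G) :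
    comp n x f u = (f fun i => MonoidAlgebra.single (u i) 1).coeff ((∏ i, u i) * x) := rfl

theorem coch_ext {n : ℕ} {f f' : Coch K (MonoidAlgebra K G) n}
    (h : ∀ u : Fin n → G, (f fun i => MonoidAlgebra.single (u i) 1) =
      f' fun i => MonoidAlgebra.single (u i) 1) : f = f' := by
  refine Module.Basis.ext_multilinear (fun _ => MonoidAlgebra.basis G K) fun v => ?_
  simpa only [MonoidAlgebra.basis_apply] using h v

theorem comp_ext {n : ℕ} {f f' : Coch K (MonoidAlgebra K G) n}
    (h : ∀ x, comp n x f = comp n x f') : f = f' := by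
  refine coch_ext fun u => ?_
  ext y
  simpa only [comp_apply, mul_inv_cancel_left] using congrFun (h ((∏ i, u i)⁻¹ * y)) u

theorem contractNth_single {n : ℕ} (i : Fin (n + 1)) (u : Fin (n + 1) → G) :
    Fin.contractNth i (· * ·) (fun j => MonoidAlgebra.single (u j) (1 : K)) =
      fun k => MonoidAlgebra.single (Fin.contractNth i (· * ·) u k) 1 :=
  (Fin.comp_contractNth _ _ (map_mul (MonoidAlgebra.of K G)) _ _).symm

theorem comp_d {n : ℕ} (x : G) (f : Coch K (MonoidAlgebra K G) n) :
    comp (n + 1) x (d n f) = gdiff n (comp n x f) := by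
  funext u
  have d_apply : d n f (fun i => MonoidAlgebra.single (u i) 1) =
      MonoidAlgebra.single (u 0) 1 * f (fun j => MonoidAlgebra.single (Fin.tail u j) 1)
        + ∑ i : Fin n, (-1 : ℤ) ^ ((i : ℕ) + 1) •
          f (fun k => MonoidAlgebra.single (Fin.contractNth i.castSucc (· * ·) u k) 1)
        + (-1 : ℤ) ^ (n + 1) • (f (fun j => MonoidAlgebra.single (Fin.init u j) 1) *
          MonoidAlgebra.single (u (Fin.last n)) 1) := by
    simp only [← contractNth_single]
    rfl
  have first : (u 0)⁻¹ * ((∏ i, u i) * x) = (∏ i, Fin.tail u i) * x := by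
    rw [Fin.prod_univ_succ, mul_assoc, inv_mul_cancel_left]
    rfl
  have last : (∏ i, u i) * x * (u (Fin.last n))⁻¹ = (∏ i, Fin.init u i) * x := by
    rw [Fin.prod_univ_castSucc, mul_right_comm, mul_inv_cancel_right]
    rfl
  rw [comp_apply, d_apply, gdiff_apply]
  simp only [comp_apply, prod_contractNth_castSucc, MonoidAlgebra.coeff_add,
    MonoidAlgebra.coeff_sum, Finsupp.add_apply, Finsupp.finsetSum_apply,
    MonoidAlgebra.coeff_smul_apply, MonoidAlgebra.coeff_single_mul_apply,
    MonoidAlgebra.coeff_mul_single_apply, one_mul, mul_one, first, last]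

end CommRing

variable {K G : Type*} [Field K] [CommGroup G] [Fintype G]

theorem comp_psi [DecidableEq G] {n : ℕ} (α : (Fin n → G) → K) (x y : G) :
    comp n x (psi α y) = if y = x then α else 0 := by
  funext u
  rw [comp_apply, psi_single, MonoidAlgebra.coeff_single, Finsupp.single_apply]
  simp only [mul_right_inj]
  split_ifs <;> rfl

theorem comp_sum_psi {n : ℕ} (α : G → (Fin n → G) → K) (x : G) :
    comp n x (∑ y, psi (α y) y) = α x := by
  classical
  simp only [map_sum, comp_psi, Finset.sum_ite_eq', Finset.mem_univ, if_true]

omit [Fintype G] in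
theorem exists_d_eq [Finite G] {n : ℕ} {f : Coch K (MonoidAlgebra K G) (n + 1)}
    (hf : ∀ x, ∃ v, gdiff n v = comp (n + 1) x f) : ∃ v, d n v = f := by
  have := Fintype.ofFinite G
  choose v hv using hf
  refine ⟨∑ x, psi (v x) x, comp_ext fun x => ?_⟩
  rw [comp_d, comp_sum_psi, hv]

theorem d_psi_eq_zero {n : ℕ} {α : (Fin n → G) → K} (hα : gdiff n α = 0) (x : G) :
    d n (psi α x) = 0 := by
  classical
  refine comp_ext fun y => ?_
  rw [comp_d, comp_psi, map_zero]
  split_ifs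
  · exact hα
  · exact map_zero _

theorem ev_psi {n : ℕ} (α : (Fin n → G) → K) (x : G) (U : ℕ → G) :
    (psi α x).ev (fun k => MonoidAlgebra.single (U k) 1) =
      α (fun j => U j) • MonoidAlgebra.single ((∏ k ∈ Finset.range n, U k) * x) 1 := by
  rw [Coch.ev, psi_single α x fun j => U j, Finset.prod_range, MonoidAlgebra.smul_single,
    smul_eq_mul, mul_one]

theorem circ_psi_psi {n m N : ℕ} (h : n + m = N + 1) (a : (Fin n → G) → K) (b : (Fin m → G) → K)
    (x z : G) : circ h (psi a x) (psi b z) = psi (groupCirc h a b z) (x * z) := by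
  refine coch_ext fun u => ?_
  obtain ⟨U, rfl⟩ := exists_seq_eq u
  have insertion (q : ℕ) (hq : q ∈ Finset.range n) :
      (psi a x).ev (ins q m ((psi b z).ev (shift q fun k => MonoidAlgebra.single (U k) 1))
        fun k => MonoidAlgebra.single (U k) 1) =
      circTerm a b z q U •
        MonoidAlgebra.single ((∏ k ∈ Finset.range N, U k) * (x * z)) 1 := by
    have hq := Finset.mem_range.1 hq
    change (psi a x).ev (ins q m ((psi b z).ev fun k => MonoidAlgebra.single (shift q U k) 1) _) = _
    rw [ev_psi b z (shift q U), ev_ins_smul _ _ _ hq,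
      comp_ins fun y : G => MonoidAlgebra.single y 1, ev_psi, prod_ins h hq, smul_smul, circTerm,
      mul_assoc, mul_comm z]
  change (circ h (psi a x) (psi b z)).ev (fun k => MonoidAlgebra.single (U k) 1) =
    (psi (groupCirc h a b z) (x * z)).ev fun k => MonoidAlgebra.single (U k) 1
  rw [ev_circ, ev_psi, groupCirc_seq, Finset.sum_smul]
  exact Finset.sum_congr rfl fun q hq => by rw [insertion q hq, smul_assoc]

end Components

section BetaOnZigzags

variable {K G : Type*} [Field K] [CommGroup G] {g : G}

theorem beta_ins_zero_zigzag (r s : ℕ) (a : G) (y : ℕ → G) :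
    beta K g (2 * r + 1) (fun j => ins 0 (2 * s + 1) a (zigzag g y) j) =
      expo g a * ∏ k ∈ Finset.range r, carry K g (y (s + k)) g := by
  have entry_zero : ins 0 (2 * s + 1) a (zigzag g y) 0 = a := rfl
  have entry_odd (k : ℕ) : ins 0 (2 * s + 1) a (zigzag g y) (2 * k + 1) = y (s + k) :=
    (ins_of_gt (by omega)).trans (zigzag_of_eq (by omega))
  have entry_even (k : ℕ) : ins 0 (2 * s + 1) a (zigzag g y) (2 * k + 2) = g :=
    (ins_of_gt (by omega)).trans (zigzag_of_even (by grind))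
  simp only [beta_seq, entry_zero, entry_odd, entry_even]

variable [Finite G] (hg : ∀ x : G, x ∈ Subgroup.zpowers g)

include hg

theorem beta_shift_odd_zigzag (s e : ℕ) (y : ℕ → G) :
    beta K g (2 * s + 1) (fun j => shift (2 * e + 1) (zigzag g y) j) =
      expo g (y e) * ∏ k ∈ Finset.range s, carry K g (y (e + 1 + k)) g := by
  have entry_zero : shift (2 * e + 1) (zigzag g y) 0 = y e := zigzag_of_eq rfl
  have entry_odd (k : ℕ) : shift (2 * e + 1) (zigzag g y) (2 * k + 1) = g :=
    zigzag_of_even (by grind)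
  have entry_even (k : ℕ) : shift (2 * e + 1) (zigzag g y) (2 * k + 2) = y (e + 1 + k) :=
    zigzag_of_eq (by omega)
  simp only [beta_seq, entry_zero, entry_odd, entry_even, carry_comm hg K g]

variable (hN : (Nat.card G : K) = 0)

include hN

theorem mul_eq_one_of_carry_ne_zero {v : G} (hv : carry K g v g ≠ 0) : v * g = 1 := by
  classical
  rw [carry_self_right hg hN, ite_ne_right_iff] at hv
  exact eq_inv_iff_mul_eq_one.1 hv.1

theorem beta_mul_apply_prod (s : ℕ) {W : ℕ → G}
    (hW : ∀ k, W (2 * k + 1) = g ∨ W (2 * k + 2) = g) (F : G → K) :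
    beta K g (2 * s + 1) (fun j => W j) * F (∏ k ∈ Finset.range (2 * s + 1), W k) =
      beta K g (2 * s + 1) (fun j => W j) * F (W 0) := by
  by_cases h : ∃ k ∈ Finset.range s, carry K g (W (2 * k + 1)) (W (2 * k + 2)) = 0
  · obtain ⟨k, hk, hk'⟩ := h
    rw [beta_seq, Finset.prod_eq_zero hk hk', mul_zero, zero_mul, zero_mul]
  · push Not at h
    have pair_eq_one (k : ℕ) (hk : k ∈ Finset.range s) : W (2 * k + 1) * W (2 * k + 2) = 1 := by
      have carry_ne_zero := h k hk
      rcases hW k with h₁ | h₂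
      · rw [h₁, carry_comm hg] at carry_ne_zero
        rw [h₁, mul_comm, mul_eq_one_of_carry_ne_zero hg hN carry_ne_zero]
      · rw [h₂] at carry_ne_zero
        rw [h₂, mul_eq_one_of_carry_ne_zero hg hN carry_ne_zero]
    rw [Finset.prod_range_succ', prod_range_double, Finset.prod_congr rfl pair_eq_one,
      Finset.prod_const_one, one_mul]

theorem circTerm_zigzag (z : G) (r s q : ℕ) (y : ℕ → G) :
    circTerm (beta K g (2 * r + 1)) (beta K g (2 * s + 1)) z q (zigzag g y) =
      beta K g (2 * s + 1) (fun j => shift q (zigzag g y) j) *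
        beta K g (2 * r + 1) fun j =>
          ins q (2 * s + 1) (zigzag g y q * z) (zigzag g y) j := by
  refine beta_mul_apply_prod hg hN s (fun k => ?_) fun a =>
    beta K g (2 * r + 1) fun j => ins q (2 * s + 1) (a * z) (zigzag g y) j
  obtain ⟨e, rfl | rfl⟩ := Nat.even_or_odd' q
  · exact .inr (zigzag_of_even (by grind))
  · exact .inl (zigzag_of_even (by grind))

theorem beta_shift_even_zigzag (s e : ℕ) (y : ℕ → G) :
    beta K g (2 * s + 1) (fun j => shift (2 * e) (zigzag g y) j) =
      ∏ k ∈ Finset.range s, carry K g (y (e + k)) g := by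
  have entry_zero : shift (2 * e) (zigzag g y) 0 = g := zigzag_of_even (by grind)
  have entry_odd (k : ℕ) : shift (2 * e) (zigzag g y) (2 * k + 1) = y (e + k) :=
    zigzag_of_eq (by omega)
  have entry_even (k : ℕ) : shift (2 * e) (zigzag g y) (2 * k + 2) = g :=
    zigzag_of_even (by grind)
  simp only [beta_seq, entry_zero, entry_odd, entry_even, expo_self_cast hg hN, one_mul]

theorem beta_ins_odd_zigzag (j l s : ℕ) (a : G) (y : ℕ → G) :
    beta K g (2 * (j + 1 + l) + 1) (fun k => ins (2 * j + 1) (2 * s + 1) a (zigzag g y) k) =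
      (∏ k ∈ Finset.range j, carry K g (y k) g) * carry K g a g *
        ∏ k ∈ Finset.range l, carry K g (y (j + 1 + (s + k))) g := by
  let V := ins (2 * j + 1) (2 * s + 1) a (zigzag g y)
  have entry_even (k : ℕ) : V (2 * k) = g := by
    obtain h | h : 2 * k < 2 * j + 1 ∨ 2 * j + 1 < 2 * k := by omega
    · exact (ins_of_lt h).trans (zigzag_of_even (by grind))
    · exact (ins_of_gt h).trans (zigzag_of_even (by grind))
  have entry_lt (k : ℕ) (hk : k ∈ Finset.range j) : V (2 * k + 1) = y k :=
    (ins_of_lt (by grind)).trans (zigzag_of_eq rfl)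
  have entry_self : V (2 * j + 1) = a := ins_self
  have entry_gt (k : ℕ) : V (2 * (j + 1 + k) + 1) = y (j + 1 + (s + k)) :=
    (ins_of_gt (by omega)).trans (zigzag_of_eq (by omega))
  refine (beta_seq g (j + 1 + l) V).trans ?_
  have even_zero : V 0 = g := entry_even 0
  have even_succ (k : ℕ) : V (2 * k + 2) = g := entry_even (k + 1)
  rw [Finset.prod_range_add, Finset.prod_range_succ,
    Finset.prod_congr rfl fun k hk => by rw [entry_lt k hk]]
  simp only [even_zero, even_succ, entry_self, entry_gt, expo_self_cast hg hN, one_mul]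

theorem beta_ins_even_zigzag (j l s : ℕ) (a : G) (y : ℕ → G) :
    beta K g (2 * (j + 1 + l) + 1) (fun k => ins (2 * (j + 1)) (2 * s + 1) a (zigzag g y) k) =
      (∏ k ∈ Finset.range j, carry K g (y k) g) * carry K g (y j) a *
        ∏ k ∈ Finset.range l, carry K g (y (j + 1 + (s + k))) g := by
  let V := ins (2 * (j + 1)) (2 * s + 1) a (zigzag g y)
  have entry_zero : V 0 = g := (ins_of_lt (by omega)).trans (zigzag_of_even Even.zero)
  have odd_le (k : ℕ) (hk : k < j + 1) : V (2 * k + 1) = y k :=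
    (ins_of_lt (by omega)).trans (zigzag_of_eq rfl)
  have even_lt (k : ℕ) (hk : k < j) : V (2 * k + 2) = g :=
    (ins_of_lt (by omega)).trans (zigzag_of_even (by grind))
  have entry_self : V (2 * j + 2) = a := ins_self
  have odd_gt (k : ℕ) : V (2 * (j + 1 + k) + 1) = y (j + 1 + (s + k)) :=
    (ins_of_gt (by omega)).trans (zigzag_of_eq (by omega))
  have even_gt (k : ℕ) : V (2 * (j + 1 + k) + 2) = g :=
    (ins_of_gt (by omega)).trans (zigzag_of_even (by grind))
  have left (k : ℕ) (hk : k ∈ Finset.range j) :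
      carry K g (V (2 * k + 1)) (V (2 * k + 2)) = carry K g (y k) g := by
    have hk := Finset.mem_range.1 hk
    rw [odd_le k (hk.trans (Nat.lt_succ_self j)), even_lt k hk]
  refine (beta_seq g (j + 1 + l) V).trans ?_
  rw [Finset.prod_range_add, Finset.prod_range_succ, Finset.prod_congr rfl left]
  simp only [entry_zero, odd_le j (Nat.lt_succ_self j), entry_self, odd_gt, even_gt,
    expo_self_cast hg hN, one_mul]

end BetaOnZigzags

section PhiOnBeta

variable {K G : Type*} [Field K] [CommGroup G] [Fintype G] {g : G}
  (hg : ∀ x : G, x ∈ Subgroup.zpowers g) (hN : (Nat.card G : K) = 0)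

include hg hN

theorem sum_carry_self : ∑ v, carry K g v g = 1 := by
  rw [sum_carry hg, expo_self_cast hg hN]

theorem sum_expo_mul_carry_mul (z : G) :
    ∑ v, (expo g v : K) * carry K g (v * z) g = -expo g (g * z) := by
  classical
  simp only [carry_self_right hg hN, ← eq_mul_inv_iff_mul_eq, mul_ite, mul_one, mul_zero,
    Finset.sum_ite_eq', Finset.mem_univ, if_true]
  rw [← expo_inv_cast hg hN, mul_inv]

theorem phi_beta (r : ℕ) : phi g r (beta K g (2 * r + 1)) = 1 := by
  have entry_even (y : ℕ → G) (k : ℕ) : zigzag g y (2 * k + 2) = g := zigzag_of_even (by grind)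
  have entry_zero (y : ℕ → G) : zigzag g y 0 = g := zigzag_of_even Even.zero
  simp only [phi_apply, beta_seq, zigzag_of_eq rfl, entry_even, entry_zero, expo_self_cast hg hN,
    one_mul]
  exact sum_prod_seqOne_eq_one (sum_carry_self hg hN)

theorem sum_circTerm_zero (z : G) (r s : ℕ) :
    ∑ y : Fin (r + s) → G, circTerm (beta K g (2 * r + 1)) (beta K g (2 * s + 1)) z 0
      (zigzag g (seqOne y)) = expo g (g * z) := by
  have term (y : ℕ → G) : circTerm (beta K g (2 * r + 1)) (beta K g (2 * s + 1)) z 0 (zigzag g y) =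
      expo g (g * z) * ∏ k ∈ Finset.range (r + s), carry K g (y k) g := by
    rw [circTerm_zigzag hg hN, beta_shift_even_zigzag hg hN s 0, beta_ins_zero_zigzag,
      add_comm r s, Finset.prod_range_add, zigzag_of_even Even.zero]
    simp only [zero_add]
    ring
  simp only [term, ← Finset.mul_sum, sum_prod_seqOne_eq_one (sum_carry_self hg hN), mul_one]

theorem sum_circTerm_odd (z : G) (j l s : ℕ) :
    ∑ y : Fin (j + 1 + l + s) → G,
      circTerm (beta K g (2 * (j + 1 + l) + 1)) (beta K g (2 * s + 1)) z (2 * j + 1)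
        (zigzag g (seqOne y)) = -expo g (g * z) := by
  have term (y : ℕ → G) :
      circTerm (beta K g (2 * (j + 1 + l) + 1)) (beta K g (2 * s + 1)) z (2 * j + 1) (zigzag g y) =
      (∏ k ∈ Finset.range j, carry K g (y k) g) * (expo g (y j) * carry K g (y j * z) g) *
        ∏ k ∈ Finset.range (s + l), carry K g (y (j + 1 + k)) g := by
    rw [circTerm_zigzag hg hN, beta_shift_odd_zigzag hg, beta_ins_odd_zigzag hg hN,
      Finset.prod_range_add _ s, zigzag_of_eq rfl]
    ring
  simp only [term]
  rw [sum_prod_mul_mul_prod_seqOne (by omega) (sum_carry_self hg hN)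
    fun v => (expo g v : K) * carry K g (v * z) g, sum_expo_mul_carry_mul hg hN]

theorem sum_circTerm_even (z : G) (j l s : ℕ) :
    ∑ y : Fin (j + 1 + l + s) → G,
      circTerm (beta K g (2 * (j + 1 + l) + 1)) (beta K g (2 * s + 1)) z (2 * (j + 1))
        (zigzag g (seqOne y)) = expo g (g * z) := by
  have term (y : ℕ → G) :
      circTerm (beta K g (2 * (j + 1 + l) + 1)) (beta K g (2 * s + 1)) z (2 * (j + 1))
        (zigzag g y) =
      (∏ k ∈ Finset.range j, carry K g (y k) g) * carry K g (y j) (g * z) *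
        ∏ k ∈ Finset.range (s + l), carry K g (y (j + 1 + k)) g := by
    rw [circTerm_zigzag hg hN, beta_shift_even_zigzag hg hN, beta_ins_even_zigzag hg hN,
      Finset.prod_range_add _ s, zigzag_of_even (even_two_mul _)]
    ring
  simp only [term]
  rw [sum_prod_mul_mul_prod_seqOne (by omega) (sum_carry_self hg hN)
    fun v => carry K g v (g * z), sum_carry hg]

/-- The insertions at the positions `2 * j + 1` and `2 * j + 2` cancel each other, so that only the
insertion at position `0` remains. -/
theorem phi_groupCirc {r s t : ℕ} (h : (2 * r + 1) + (2 * s + 1) = (2 * t + 1) + 1) (z : G) :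
    phi g t (groupCirc h (beta K g (2 * r + 1)) (beta K g (2 * s + 1)) z) = expo g z + 1 := by
  obtain rfl : t = r + s := by omega
  have sign (q : ℕ) : (-1 : ℤ) ^ (q * (2 * s + 1 + 1)) = 1 :=
    ((odd_two_mul_add_one s).add_one.mul_left q).neg_one_pow
  have cancel (j : ℕ) (hj : j ∈ Finset.range r) :
      ∑ y : Fin (r + s) → G, circTerm (beta K g (2 * r + 1)) (beta K g (2 * s + 1)) z (2 * j + 1)
          (zigzag g (seqOne y)) +
        ∑ y : Fin (r + s) → G, circTerm (beta K g (2 * r + 1)) (beta K g (2 * s + 1)) z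
          (2 * j + 1 + 1) (zigzag g (seqOne y)) = 0 := by
    obtain ⟨l, rfl⟩ := Nat.exists_eq_add_of_le (Nat.succ_le_of_lt (Finset.mem_range.1 hj))
    exact (congrArg₂ _ (sum_circTerm_odd hg hN z j l s) (sum_circTerm_even hg hN z j l s)).trans
      (neg_add_cancel _)
  simp only [phi_apply, groupCirc_seq, sign, one_smul]
  rw [Finset.sum_comm, Finset.sum_range_succ', sum_range_double, Finset.sum_congr rfl cancel,
    Finset.sum_const_zero, zero_add, sum_circTerm_zero hg hN, expo_mul_cast hg hN,
    expo_self_cast hg hN, add_comm]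

end PhiOnBeta

section Classes

variable {K A : Type*} [CommRing K] [Ring A] [Algebra K A]

theorem cls_eq_zero {r : ℕ} {f : Cocycle K A (2 * r + 1)} {v : Coch K A (2 * r)}
    (h : d (2 * r) v = f) : cls r f = 0 := by
  refine (LieSubmodule.Quotient.mk_eq_zero' (N := oddCoboundaries K A)).2 fun s => ?_
  change ∃ h, d (2 * s) h = coord s (single r (f : Coch K A (2 * r + 1)))
  obtain rfl | hs := eq_or_ne r s
  · exact ⟨v, by rw [coord_single_same]; exact h⟩
  · exact ⟨0, by rw [coord_single_ne hs, map_zero]⟩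

/-- The functional on `HH ^ odd` induced by a functional on cochains of degree `2 * r + 1` that
vanishes on coboundaries. -/
def descend (r : ℕ) (φ : Coch K A (2 * r + 1) →ₗ[K] K) (hφ : φ ∘ₗ d (2 * r) = 0) :
    HHodd K A →ₗ[K] K :=
  (oddCoboundaries K A).toSubmodule.liftQ
    (φ ∘ₗ coord r ∘ₗ (oddCocycles K A).toSubmodule.subtype) fun F hF => by
      obtain ⟨v, hv⟩ := hF r
      change φ (coord r (F : OddCoch K A)) = 0
      rw [← hv]
      exact LinearMap.congr_fun hφ v

theorem descend_cls {r : ℕ} {φ : Coch K A (2 * r + 1) →ₗ[K] K} (hφ : φ ∘ₗ d (2 * r) = 0) (s : ℕ)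
    (f : Cocycle K A (2 * s + 1)) :
    descend r φ hφ (cls s f) = φ (coord r (single s (f : Coch K A (2 * s + 1)))) := rfl

theorem eq_top_of_cls_mem {S : Submodule K (HHodd K A)}
    (h : ∀ r (f : Cocycle K A (2 * r + 1)), cls r f ∈ S) : S = ⊤ := by
  classical
  refine eq_top_iff.2 fun x _ => ?_
  obtain ⟨⟨F, hF⟩, rfl⟩ := LieSubmodule.Quotient.surjective_mk' (oddCoboundaries K A) x
  have sum_components : (⟨F, hF⟩ : oddCocycles K A) =
      ∑ r ∈ DFinsupp.support (show ⨁ r : ℕ, Coch K A (2 * r + 1) from F),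
        toOddCocycles r ⟨coord r F, LinearMap.mem_ker.2 (hF r)⟩ := by
    apply Subtype.ext
    rw [AddSubmonoidClass.coe_finsetSum]
    exact (DirectSum.sum_support_of (β := fun r => Coch K A (2 * r + 1)) F).symm
  rw [sum_components, map_sum]
  exact Submodule.sum_mem _ fun r _ => h r _

end Classes

section BetaClasses

variable {G K : Type*} [Field K] [CommGroup G] [Fintype G] {g : G}
  (hg : ∀ x : G, x ∈ Subgroup.zpowers g) (hN : (Nat.card G : K) = 0)

/-- The cocycle `β ^ (2 * r + 1) ⊗ x`. -/
def betaCocycle (r : ℕ) (x : G) : Cocycle K (MonoidAlgebra K G) (2 * r + 1) :=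
  ⟨psi (beta K g (2 * r + 1)) x, LinearMap.mem_ker.2 (d_psi_eq_zero (gdiff_beta hg hN r) x)⟩

theorem coe_betaCocycle (r : ℕ) (x : G) :
    (betaCocycle hg hN r x : Coch K (MonoidAlgebra K G) (2 * r + 1)) =
      psi (beta K g (2 * r + 1)) x := rfl

/-- The class of `β ^ (2 * r + 1) ⊗ x` in `HH ^ odd (K G)`. -/
def betaCls (r : ℕ) (x : G) : HHodd K (MonoidAlgebra K G) := cls r (betaCocycle hg hN r x)

/-- The functional on `HH ^ odd (K G)` that reads off the coefficient of the class of
`β ^ (2 * r + 1) ⊗ x`. -/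
def betaCoeff (g : G) (r : ℕ) (x : G) : HHodd K (MonoidAlgebra K G) →ₗ[K] K :=
  descend r (phi g r ∘ₗ comp (2 * r + 1) x) <| LinearMap.ext fun v => by
    simp only [LinearMap.comp_apply, comp_d, phi_gdiff, LinearMap.zero_apply]

theorem betaCoeff_betaCls [DecidableEq G] (r s : ℕ) (x y : G) :
    betaCoeff g r x (betaCls hg hN s y) = if (s, y) = (r, x) then 1 else 0 := by
  rw [betaCoeff, betaCls, descend_cls, coe_betaCocycle, LinearMap.comp_apply]
  obtain rfl | hsr := eq_or_ne s r
  · rw [coord_single_same, comp_psi, apply_ite (phi g s), phi_beta hg hN, map_zero]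
    simp only [Prod.mk.injEq, true_and]
  · rw [coord_single_ne hsr, map_zero, map_zero, if_neg fun h => hsr (congrArg Prod.fst h)]

include hg hN in
theorem exists_eq_phi_smul_beta_add_gdiff {r : ℕ} {f : (Fin (2 * r + 1) → G) → K}
    (hf : gdiff (2 * r + 1) f = 0) :
    ∃ v, f = phi g r f • beta K g (2 * r + 1) + gdiff (2 * r) v := by
  have beta_not_coboundary (v : (Fin (2 * r) → G) → K) : gdiff (2 * r) v ≠ beta K g (2 * r + 1) :=
    fun hv => one_ne_zero (α := K) <| by rw [← phi_beta hg hN r, ← hv, phi_gdiff]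
  obtain ⟨c, v, hv⟩ := exists_eq_smul_add_gdiff hg (odd_two_mul_add_one r) (gdiff_beta hg hN r)
    beta_not_coboundary hf
  have phi_eq : phi g r f = c := by
    rw [hv, map_add, map_smul, phi_gdiff, phi_beta hg hN, add_zero, smul_eq_mul, mul_one]
  exact ⟨v, by rw [phi_eq, ← hv]⟩

theorem cls_eq_sum (r : ℕ) (f : Cocycle K (MonoidAlgebra K G) (2 * r + 1)) :
    cls r f = ∑ x : G,
      phi g r (comp (2 * r + 1) x (f : Coch K (MonoidAlgebra K G) (2 * r + 1))) •
        betaCls hg hN r x := by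
  classical
  let c (x : G) : K := phi g r (comp (2 * r + 1) x (f : Coch K (MonoidAlgebra K G) (2 * r + 1)))
  let rest : Cocycle K (MonoidAlgebra K G) (2 * r + 1) := f - ∑ x, c x • betaCocycle hg hN r x
  have comp_rest (x : G) : comp (2 * r + 1) x (rest : Coch K (MonoidAlgebra K G) (2 * r + 1)) =
      comp (2 * r + 1) x (f : Coch K (MonoidAlgebra K G) (2 * r + 1)) -
        c x • beta K g (2 * r + 1) := by
    simp only [rest, AddSubgroupClass.coe_sub, AddSubmonoidClass.coe_finsetSum,
      SetLike.val_smul, coe_betaCocycle, map_sub, map_sum, map_smul, comp_psi, smul_ite, smul_zero,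
      Finset.sum_ite_eq', Finset.mem_univ, if_true]
  have component_exact (x : G) : ∃ v, gdiff (2 * r) v =
      comp (2 * r + 1) x (rest : Coch K (MonoidAlgebra K G) (2 * r + 1)) := by
    obtain ⟨v, hv⟩ := exists_eq_phi_smul_beta_add_gdiff hg hN (r := r)
      (f := comp (2 * r + 1) x (f : Coch K (MonoidAlgebra K G) (2 * r + 1))) <| by
        rw [← comp_d, Cocycle.d_eq_zero, map_zero]
    exact ⟨v, by rw [comp_rest, eq_sub_iff_add_eq', ← hv]⟩
  obtain ⟨v, hv⟩ := exists_d_eq component_exact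
  rw [← sub_eq_zero]
  simp only [betaCls, ← map_smul, ← map_sum, ← map_sub]
  exact cls_eq_zero hv

theorem lie_betaCls (r s : ℕ) (x z : G) :
    ⁅betaCls hg hN r x, betaCls hg hN s z⁆ =
      ((expo g z : K) - expo g x) • betaCls hg hN (r + s) (x * z) := by
  classical
  have comp_gerst (y : G) : phi g (r + s) (comp (2 * (r + s) + 1) y
      (gerstCocycle r s (betaCocycle hg hN r x) (betaCocycle hg hN s z) :
        Coch K (MonoidAlgebra K G) (2 * (r + s) + 1))) =
      if x * z = y then (expo g z : K) - expo g x else 0 := by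
    change phi g (r + s) (comp _ y (gerst (odd_add r s) (psi (beta K g (2 * r + 1)) x)
      (psi (beta K g (2 * s + 1)) z))) = _
    rw [gerst_odd _ (by omega), circ_psi_psi, circ_psi_psi, map_sub, map_sub, comp_psi, comp_psi,
      mul_comm z x, apply_ite (phi g (r + s)), apply_ite (phi g (r + s)), phi_groupCirc hg hN,
      phi_groupCirc hg hN, map_zero]
    split_ifs <;> ring
  refine (lie_cls r s (betaCocycle hg hN r x) (betaCocycle hg hN s z)).trans ?_
  rw [cls_eq_sum hg hN]
  simp only [comp_gerst, ite_smul, zero_smul, Finset.sum_ite_eq, Finset.mem_univ, if_true]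

theorem linearIndependent_betaCls :
    LinearIndependent K fun i : ℕ × G => betaCls hg hN i.1 i.2 := by
  classical
  refine linearIndependent_iff'.2 fun s c hc i hi => ?_
  have := congrArg (betaCoeff g i.1 i.2) hc
  simpa [betaCoeff_betaCls, hi] using this

/-- The classes of the cocycles `β ^ (2 * r + 1) ⊗ x` form a basis of `HH ^ odd (K G)`. -/
def betaBasis : Module.Basis (ℕ × G) K (HHodd K (MonoidAlgebra K G)) :=
  Module.Basis.mk (linearIndependent_betaCls hg hN)
    (top_le_iff.2 <| eq_top_of_cls_mem fun r f => by
      rw [cls_eq_sum hg hN]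
      exact Submodule.sum_mem _ fun x _ =>
        Submodule.smul_mem _ _ (Submodule.subset_span ⟨(r, x), rfl⟩))

theorem betaBasis_apply (r : ℕ) (x : G) : betaBasis hg hN (r, x) = betaCls hg hN r x :=
  Module.Basis.mk_apply ..

end BetaClasses

section Derivations

variable {K A : Type*} [CommRing K] [CommRing A] [Algebra K A]

theorem cocycle_one_mul {f : Coch K A 1} (hf : d 1 f = 0) (a b : A) :
    f (fun _ => a * b) = a * f (fun _ => b) + b * f (fun _ => a) := by
  have d_apply : d 1 f ![a, b] = a * f (Fin.tail ![a, b]) +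
      ∑ i : Fin 1, (-1 : ℤ) ^ ((i : ℕ) + 1) • f (i.castSucc.contractNth (· * ·) ![a, b]) +
        (-1 : ℤ) ^ 2 • (f (Fin.init ![a, b]) * b) := rfl
  have tail_eq : Fin.tail ![a, b] = fun _ => b := funext fun i => by fin_cases i; rfl
  have init_eq : Fin.init ![a, b] = fun _ => a := funext fun i => by fin_cases i; rfl
  have contract_eq : Fin.contractNth (Fin.castSucc (0 : Fin 1)) (· * ·) ![a, b] = fun _ => a * b :=
    funext fun i => by fin_cases i; rfl
  rw [hf, zero_apply, Fin.sum_univ_one, tail_eq, init_eq, contract_eq] at d_apply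
  simp only [Fin.val_zero, zero_add, pow_one, neg_smul, one_smul, even_two, Even.neg_pow,
    one_pow] at d_apply
  linear_combination d_apply

/-- The derivation of a commutative algebra given by a Hochschild cocycle of degree `1`. -/
def derivationOfCocycle (f : Cocycle K A 1) : Derivation K A A :=
  Derivation.mk' ((MultilinearMap.ofSubsingleton K A A (0 : Fin 1)).symm (f : Coch K A 1))
    (cocycle_one_mul (Cocycle.d_eq_zero f))

theorem coe_derClass {D : Derivation K A A} {f : Cocycle K A 1}
    (h : MultilinearMap.ofSubsingleton K A A (0 : Fin 1) D.toLinearMap = (f : Coch K A 1)) :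
    (derClass D : HHodd K A) = cls 0 f :=
  congrArg (cls 0) (Subtype.ext h)

theorem coe_derClass_derivationOfCocycle (f : Cocycle K A 1) :
    (derClass (derivationOfCocycle f) : HHodd K A) = cls 0 f :=
  coe_derClass (Equiv.apply_symm_apply _ _)

theorem lie_derClass (D D' : Derivation K A A) : ⁅derClass D, derClass D'⁆ = derClass ⁅D, D'⁆ := by
  refine Subtype.ext ((lie_cls 0 0 ⟨_, LinearMap.mem_ker.2 (d_derivation D)⟩
    ⟨_, LinearMap.mem_ker.2 (d_derivation D')⟩).trans
      (coe_derClass (Coch.ext_ev fun x => ?_)).symm)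
  change ⁅D, D'⁆ (x 0) = (gerst (odd_add 0 0) _ _ : Coch K A (2 * (0 + 0) + 1)).ev x
  rw [gerst_odd _ (by omega), ev_sub, ev_circ, ev_circ, Derivation.commutator_apply]
  simp [Coch.ev, ins, shift]

end Derivations

theorem derivation_ext_single {G K : Type*} [Field K] [CommGroup G]
    {D D' : Derivation K (MonoidAlgebra K G) (MonoidAlgebra K G)}
    (h : ∀ w : G, D (MonoidAlgebra.single w 1) = D' (MonoidAlgebra.single w 1)) : D = D' := by
  have : D.toLinearMap = D'.toLinearMap :=
    (MonoidAlgebra.basis G K).ext fun w => by simpa using h w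
  exact Derivation.ext fun a => LinearMap.congr_fun this a

section BetaDerivations

variable {G K : Type*} [Field K] [CommGroup G] [Fintype G] {g : G}
  (hg : ∀ x : G, x ∈ Subgroup.zpowers g) (hN : (Nat.card G : K) = 0)

/-- The derivation `u ↦ i u x` for `u = g ^ i`, given by the cocycle `β ^ 1 ⊗ x`. -/
def betaDer (x : G) : Derivation K (MonoidAlgebra K G) (MonoidAlgebra K G) :=
  derivationOfCocycle (betaCocycle hg hN 0 x)

theorem betaDer_single (x w : G) : betaDer hg hN x (MonoidAlgebra.single w 1) =
    (expo g w : K) • MonoidAlgebra.single (w * x) 1 := by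
  refine (psi_single (beta K g 1) x fun _ => w).trans ?_
  rw [beta_seq g 0 fun _ => w]
  simp

theorem lie_betaDer (x z : G) : ⁅betaDer hg hN x, betaDer hg hN z⁆ =
    ((expo g z : K) - expo g x) • betaDer hg hN (x * z) := by
  refine derivation_ext_single fun w => ?_
  rw [Derivation.commutator_apply, Derivation.smul_apply]
  simp only [betaDer_single, Derivation.map_smul, expo_mul_cast hg hN, mul_assoc, mul_comm z x]
  module

theorem coe_derClass_betaDer (x : G) :
    (derClass (betaDer hg hN x) : HHodd K (MonoidAlgebra K G)) = betaCls hg hN 0 x :=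
  coe_derClass_derivationOfCocycle _

theorem linearIndependent_derClass_betaDer :
    LinearIndependent K fun x : G => derClass (betaDer hg hN x) := by
  have coe_family : (HH1 K (MonoidAlgebra K G)).toSubmodule.subtype ∘
      (fun x : G => derClass (betaDer hg hN x)) = fun x => betaCls hg hN 0 x :=
    funext (coe_derClass_betaDer hg hN)
  refine LinearIndependent.of_comp (HH1 K (MonoidAlgebra K G)).toSubmodule.subtype ?_
  rw [coe_family]
  exact (linearIndependent_betaCls hg hN).comp (fun x => (0, x)) fun x y h => congrArg Prod.snd h

theorem span_derClass_betaDer :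
    Submodule.span K (Set.range fun x : G => derClass (betaDer hg hN x)) = ⊤ := by
  refine eq_top_iff.2 ?_
  rintro ⟨_, f, rfl⟩ -
  have eq_sum : (⟨cls 0 f, f, rfl⟩ : HH1 K (MonoidAlgebra K G)) =
      ∑ x : G, phi g 0 (comp (2 * 0 + 1) x (f : Coch K (MonoidAlgebra K G) (2 * 0 + 1))) •
        derClass (betaDer hg hN x) := by
    refine Subtype.ext ((cls_eq_sum hg hN 0 f).trans ?_)
    rw [AddSubmonoidClass.coe_finsetSum]
    exact Finset.sum_congr rfl fun x _ => by
      rw [SetLike.val_smul, coe_derClass_betaDer]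
  change (⟨cls 0 f, f, rfl⟩ : HH1 K (MonoidAlgebra K G)) ∈ _
  rw [eq_sum]
  exact Submodule.sum_mem _ fun x _ => Submodule.smul_mem _ _ (Submodule.subset_span ⟨x, rfl⟩)

/-- The classes of the derivations `u ↦ i u x` form a basis of `HH ^ 1 (K G)`. -/
def derBasis : Module.Basis G K (HH1 K (MonoidAlgebra K G)) :=
  Module.Basis.mk (linearIndependent_derClass_betaDer hg hN) (span_derClass_betaDer hg hN).ge

theorem derBasis_apply (x : G) : derBasis hg hN x = derClass (betaDer hg hN x) :=
  Module.Basis.mk_apply ..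

end BetaDerivations

section CurrentAlgebra

theorem map_lie_of_basis {ι K L M : Type*} [CommRing K] [LieRing L] [LieAlgebra K L] [LieRing M]
    [LieAlgebra K M] (b : Module.Basis ι K L) {f : L →ₗ[K] M}
    (h : ∀ i j, f ⁅b i, b j⁆ = ⁅f (b i), f (b j)⁆) (x y : L) : f ⁅x, y⁆ = ⁅f x, f y⁆ := by
  have brackets_eq : (LieModule.toEnd K L L : L →ₗ[K] L →ₗ[K] L).compr₂ f =
      (LieModule.toEnd K M M : M →ₗ[K] M →ₗ[K] M).compl₁₂ f f :=
    b.ext fun i => b.ext fun j => h i j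
  exact LinearMap.congr_fun (LinearMap.congr_fun brackets_eq x) y

theorem pow_tmul_lie_pow_tmul {K L : Type*} [CommRing K] [LieRing L] [LieAlgebra K L] (r s : ℕ)
    (x y : L) : ⁅(Polynomial.X ^ r : K[X]) ⊗ₜ[K] x, (Polynomial.X ^ s : K[X]) ⊗ₜ[K] y⁆ =
      (Polynomial.X ^ (r + s) : K[X]) ⊗ₜ[K] ⁅x, y⁆ := by
  rw [LieAlgebra.ExtendScalars.bracket_tmul, pow_add]

variable {G K : Type*} [Field K] [CommGroup G] [Fintype G] {g : G}
  (hg : ∀ x : G, x ∈ Subgroup.zpowers g) (hN : (Nat.card G : K) = 0)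

/-- The linear equivalence that sends the class of `β ^ (2 * r + 1) ⊗ x` to the tensor product of
`t ^ r` and the class of the derivation `betaDer x`. -/
def currentLinearEquiv : HHodd K (MonoidAlgebra K G) ≃ₗ[K] K[X] ⊗[K] HH1 K (MonoidAlgebra K G) :=
  (betaBasis hg hN).equiv ((Polynomial.basisMonomials K).tensorProduct (derBasis hg hN))
    (Equiv.refl _)

theorem currentLinearEquiv_betaCls (r : ℕ) (x : G) :
    currentLinearEquiv hg hN (betaCls hg hN r x) =
      (Polynomial.X ^ r : K[X]) ⊗ₜ[K] derClass (betaDer hg hN x) := by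
  rw [currentLinearEquiv, ← betaBasis_apply, Module.Basis.equiv_apply, Equiv.refl_apply,
    Module.Basis.tensorProduct_apply, derBasis_apply, Polynomial.coe_basisMonomials]
  exact congrArg (· ⊗ₜ[K] _) (Polynomial.monomial_one_right_eq_X_pow r)

theorem lie_derClass_betaDer (x z : G) :
    ⁅derClass (betaDer hg hN x), derClass (betaDer hg hN z)⁆ =
      ((expo g z : K) - expo g x) • derClass (betaDer hg hN (x * z)) := by
  refine Subtype.ext ?_
  rw [LieSubalgebra.coe_bracket, SetLike.val_smul, coe_derClass_betaDer, coe_derClass_betaDer,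
    coe_derClass_betaDer, lie_betaCls]

/-- The isomorphism of `HH ^ odd (K G)` with the current Lie algebra of `HH ^ 1 (K G)`. -/
def currentLieEquiv : HHodd K (MonoidAlgebra K G) ≃ₗ⁅K⁆ K[X] ⊗[K] HH1 K (MonoidAlgebra K G) :=
  { currentLinearEquiv hg hN with
    map_lie' := fun {a b} => by
      refine map_lie_of_basis (betaBasis hg hN) (f := (currentLinearEquiv hg hN).toLinearMap)
        (fun (r, x) (s, z) => ?_) a b
      simp only [betaBasis_apply, lie_betaCls, LinearEquiv.coe_coe, map_smul,
        currentLinearEquiv_betaCls, pow_tmul_lie_pow_tmul, lie_derClass_betaDer,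
        TensorProduct.tmul_smul] }

theorem currentLieEquiv_betaCls (r : ℕ) (x : G) :
    currentLieEquiv hg hN (betaCls hg hN r x) =
      (Polynomial.X ^ r : K[X]) ⊗ₜ[K] derClass (betaDer hg hN x) :=
  currentLinearEquiv_betaCls hg hN r x

theorem betaDer_pow_single_gen (i : ℕ) : betaDer hg hN (g ^ i) (MonoidAlgebra.single g 1) =
    MonoidAlgebra.single (g ^ (i + 1)) 1 := by
  rw [betaDer_single, expo_self_cast hg hN, one_smul, pow_succ']

theorem lie_betaDer_pow (i j : ℕ) : ⁅betaDer hg hN (g ^ i), betaDer hg hN (g ^ j)⁆ =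
    ((j : K) - (i : K)) • betaDer hg hN (g ^ (i + j)) := by
  rw [lie_betaDer, expo_pow_cast hg hN, expo_pow_cast hg hN, ← pow_add]

theorem span_derClass_betaDer_pow :
    Submodule.span K (Set.range fun i : ℕ => derClass (betaDer hg hN (g ^ i))) = ⊤ := by
  refine top_le_iff.1 ((span_derClass_betaDer hg hN).ge.trans (Submodule.span_mono ?_))
  rintro _ ⟨x, rfl⟩
  exact ⟨expo g x, by simp only [pow_expo hg]⟩

end CurrentAlgebra

end Hochschild

end

theorem mainTheorem6_general {K G : Type*} [Field K] [CommGroup G] [Fintype G]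
    (hN : (Nat.card G : K) = 0) (g : G) (hg : ∀ x : G, x ∈ Subgroup.zpowers g) :
    ∃ (D : ℕ → Derivation K (MonoidAlgebra K G) (MonoidAlgebra K G))
      (hβ : ∀ r i : ℕ, Hochschild.psi (Hochschild.beta K g (2 * r + 1)) (g ^ i) ∈
        Hochschild.Cocycle K (MonoidAlgebra K G) (2 * r + 1))
      (e : Hochschild.HHodd K (MonoidAlgebra K G) ≃ₗ⁅K⁆
        K[X] ⊗[K] Hochschild.HH1 K (MonoidAlgebra K G)),
      (∀ i : ℕ, D i (MonoidAlgebra.single g 1) = MonoidAlgebra.single (g ^ (i + 1)) 1) ∧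
      (∀ i j : ℕ, ⁅D i, D j⁆ = ((j : K) - (i : K)) • D (i + j)) ∧
      Submodule.span K (Set.range fun i => Hochschild.derClass (D i)) = ⊤ ∧
      (∀ i j r s : ℕ,
        ⁅(Polynomial.X ^ r : K[X]) ⊗ₜ[K] Hochschild.derClass (D i),
          (Polynomial.X ^ s : K[X]) ⊗ₜ[K] Hochschild.derClass (D j)⁆ =
        (Polynomial.X ^ (r + s) : K[X]) ⊗ₜ[K] Hochschild.derClass ⁅D i, D j⁆) ∧
      ∀ r i : ℕ,
        e (Hochschild.cls r
          ⟨Hochschild.psi (Hochschild.beta K g (2 * r + 1)) (g ^ i), hβ r i⟩) =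
        (Polynomial.X ^ r : K[X]) ⊗ₜ[K] Hochschild.derClass (D i) :=
  open Hochschild in
  ⟨fun i => betaDer hg hN (g ^ i),
    fun r i => (betaCocycle hg hN r (g ^ i)).2,
    currentLieEquiv hg hN,
    betaDer_pow_single_gen hg hN,
    lie_betaDer_pow hg hN,
    span_derClass_betaDer_pow hg hN,
    fun i j r s => by rw [pow_tmul_lie_pow_tmul, lie_derClass],
    fun r i => currentLieEquiv_betaCls hg hN r (g ^ i)⟩

theorem mainTheorem6 {K G : Type*} [Field K] [CommGroup G] [Fintype G]
    (p : ℕ) [Fact p.Prime] (hp : p ≠ 2) [CharP K p] (hG : p ∣ Fintype.card G)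
    (g : G) (hg : ∀ x : G, x ∈ Subgroup.zpowers g) :
    ∃ (D : ℕ → Derivation K (MonoidAlgebra K G) (MonoidAlgebra K G))
      (hβ : ∀ r i : ℕ, Hochschild.psi (Hochschild.beta K g (2 * r + 1)) (g ^ i) ∈
        Hochschild.Cocycle K (MonoidAlgebra K G) (2 * r + 1))
      (e : Hochschild.HHodd K (MonoidAlgebra K G) ≃ₗ⁅K⁆
        K[X] ⊗[K] Hochschild.HH1 K (MonoidAlgebra K G)),
      (∀ i : ℕ, D i (MonoidAlgebra.single g 1) = MonoidAlgebra.single (g ^ (i + 1)) 1) ∧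
      (∀ i j : ℕ, ⁅D i, D j⁆ = ((j : K) - (i : K)) • D (i + j)) ∧
      Submodule.span K (Set.range fun i => Hochschild.derClass (D i)) = ⊤ ∧
      (∀ i j r s : ℕ,
        ⁅(Polynomial.X ^ r : K[X]) ⊗ₜ[K] Hochschild.derClass (D i),
          (Polynomial.X ^ s : K[X]) ⊗ₜ[K] Hochschild.derClass (D j)⁆ =
        (Polynomial.X ^ (r + s) : K[X]) ⊗ₜ[K] Hochschild.derClass ⁅D i, D j⁆) ∧
      ∀ r i : ℕ,
        e (Hochschild.cls r
          ⟨Hochschild.psi (Hochschild.beta K g (2 * r + 1)) (g ^ i), hβ r i⟩) =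
        (Polynomial.X ^ r : K[X]) ⊗ₜ[K] Hochschild.derClass (D i) :=
  mainTheorem6_general (by rw [Nat.card_eq_fintype_card]; exact (CharP.cast_eq_zero_iff K p _).2 hG)
    g hg
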